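/- **Definitions.** For $n\ge 0$ let $C_n$ be the poset of nonempty subintervals $\{i,i+1,\dots,j\}$ of $\{0,\dots,n\}$, ordered by reverse inclusion and regarded as a category; a monotone map $\theta$ induces the functor $\{i,\dots,j\}\mapsto\{\theta(i),\dots,\theta(j)\}$. For a category $\mathcal C$ with pullbacks, $\mathrm{Span}(\mathcal C)$ is the simplicial set whose $n$-simplices are the functors $F:C_n\to\mathcal C$ such that, whenever $I,J\in C_n$ have nonempty intersection, the square formed by $F(I\cup J)$, $F(I)$, $F(J)$, $F(I\cap J)$ is a pullback. So a $1$-simplex, read as a morphism from $F_0$ to $F_1$, is a span $F_0\leftarrow F_{01}\rightarrow F_1$ in $\mathcal C$. Let $\mathrm{Span}=\mathrm{Span}(\mathrm{FinSet})$ and $\mathrm{Span}^\times=\mathrm{Span}(\mathrm{Arr}(\mathrm{FinSet}))$, where $\mathrm{Arr}(\mathrm{FinSet})$ is the category of arrows of finite sets, and let $p:\mathrm{Span}^\times\to\mathrm{Span}$ be the map induced by the codomain functor $(X\to Y)\mapsto Y$. For a simplicial set $A$ and a simplex $\sigma:\Delta^k\to A$, the slice $A_{/\sigma}$ has as $n$-simplices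 the maps $\Delta^n\star\Delta^k\to A$ extending $\sigma$. For a map $q:A\to B$ of simplicial sets, a $1$-simplex $f:x\to y$ of $A$ is *$q$-cartesian* if the natural map $$A_{/f}\longrightarrow A_{/y}\times_{B_{/q(y)}}B_{/q(f)}$$ is an acyclic Kan fibration, i.e. has the right lifting property with respect to $\partial\Delta^n\to\Delta^n$ for all $n\ge 0$. **Theorem.** Let $F$ be a $1$-simplex of $\mathrm{Span}^\times$, that is, a commutative diagram of finite sets $$\begin{array}{ccccc} X_0&\xleftarrow{\ \lambda^X_{01}\ }&X_{01}&\xrightarrow{\ \rho^X_{01}\ }&X_1\\ \downarrow&&\downarrow&&\downarrow\\ Y_0&\xleftarrow{\ \lambda^Y_{01}\ }&Y_{01}&\xrightarrow{\ \rho^Y_{01}\ }&Y_1, \end{array}$$ regarded as a morphism from $(X_0\to Y_0)$ to $(X_1\to Y_1)$. Then $F$ is $p$-cartesian if and only if the right-hand square is a pullback and $\lambda^X_{01}$ is an isomorphism. -/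

import Mathlib

open CategoryTheory CategoryTheory.Limits Opposite Simplicial

universe v u v' u'

/-! ### Joins of simplices, slices of simplicial sets, cartesian edges -/

namespace SSetSlice

/-- The ordinal join `[a] ⋆ [b] = [a + 1 + b]`. -/
abbrev join (a b : SimplexCategory) : SimplexCategory := ⦋a.len + 1 + b.len⦌

/-- The action of the join on monotone maps: `θ` acts on the first `a + 1` vertices and `φ` on the
last `b + 1` vertices. -/
def joinMap {a a' b b' : SimplexCategory} (θ : a ⟶ a') (φ : b ⟶ b') : join a b ⟶ join a' b' :=
  SimplexCategory.mkHom
    { toFun := fun i =>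
        if h : i.1 < a.len + 1 then
          ⟨(θ.toOrderHom ⟨i.1, h⟩).1, by have := (θ.toOrderHom ⟨i.1, h⟩).2; omega⟩
        else
          ⟨a'.len + 1 + (φ.toOrderHom ⟨i.1 - (a.len + 1), by have := i.2; omega⟩).1, by
            have := (φ.toOrderHom ⟨i.1 - (a.len + 1), by have := i.2; omega⟩).2; omega⟩
      monotone' := by
        intro i j hij
        have hij' : i.1 ≤ j.1 := hij
        by_cases hi : i.1 < a.len + 1 <;> by_cases hj : j.1 < a.len + 1
        · simp only [hi, hj, dif_pos]
          exact θ.toOrderHom.monotone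
            (show (⟨i.1, hi⟩ : Fin (a.len + 1)) ≤ ⟨j.1, hj⟩ from hij')
        · simp only [hi, hj, dif_pos, dif_neg, not_false_eq_true]
          have := (θ.toOrderHom ⟨i.1, hi⟩).2
          rw [Fin.le_def]
          simp only
          omega
        · omega
        · simp only [hi, hj, dif_neg, not_false_eq_true]
          have h : φ.toOrderHom ⟨i.1 - (a.len + 1), by have := i.2; omega⟩ ≤
              φ.toOrderHom ⟨j.1 - (a.len + 1), by have := j.2; omega⟩ :=
            φ.toOrderHom.monotone (by rw [Fin.le_def]; simp only; omega)
          rw [Fin.le_def] at h ⊢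
          simp only
          omega }

/-- The inclusion of the last `b + 1` vertices. -/
def joinInr (a b : SimplexCategory) : b ⟶ join a b :=
  SimplexCategory.mkHom
    { toFun := fun i => ⟨a.len + 1 + i.1, by have := i.2; omega⟩
      monotone' := by
        intro i j hij
        have hij' : i.1 ≤ j.1 := hij
        rw [Fin.le_def]
        simp only
        omega }

lemma joinMap_left {a a' b b' : SimplexCategory} (θ : a ⟶ a') (φ : b ⟶ b')
    (i : Fin ((join a b).len + 1)) (h : i.1 < a.len + 1) :
    ((joinMap θ φ).toOrderHom i).1 = (θ.toOrderHom ⟨i.1, h⟩).1 :=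
  congrArg Fin.val (dif_pos h)

lemma joinMap_right {a a' b b' : SimplexCategory} (θ : a ⟶ a') (φ : b ⟶ b')
    (i : Fin ((join a b).len + 1)) (j : Fin (b.len + 1)) (h : i.1 = a.len + 1 + j.1) :
    ((joinMap θ φ).toOrderHom i).1 = a'.len + 1 + (φ.toOrderHom j).1 := by
  refine (congrArg Fin.val (dif_neg (by omega))).trans ?_
  have : (⟨i.1 - (a.len + 1), by have := i.2; omega⟩ : Fin (b.len + 1)) = j :=
    Fin.ext (by simp only; omega)
  simp only [this]

lemma join_cases {a b : SimplexCategory} (i : Fin ((join a b).len + 1)) :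
    i.1 < a.len + 1 ∨ ∃ j : Fin (b.len + 1), i.1 = a.len + 1 + j.1 := by
  by_cases h : i.1 < a.len + 1
  · exact Or.inl h
  · have h2 : i.1 < a.len + 1 + b.len + 1 := i.2
    exact Or.inr ⟨⟨i.1 - (a.len + 1), by omega⟩, by simp only; omega⟩

lemma joinMap_id (a b : SimplexCategory) : joinMap (𝟙 a) (𝟙 b) = 𝟙 (join a b) := by
  refine SimplexCategory.Hom.ext _ _ (OrderHom.ext _ _ (funext fun i => Fin.ext ?_))
  obtain h | ⟨j, h⟩ := join_cases i
  · exact joinMap_left _ _ i h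
  · exact (joinMap_right _ _ i j h).trans h.symm

lemma joinMap_comp {a a' a'' b b' b'' : SimplexCategory} (θ : a ⟶ a') (θ' : a' ⟶ a'')
    (φ : b ⟶ b') (φ' : b' ⟶ b'') :
    joinMap (θ ≫ θ') (φ ≫ φ') = joinMap θ φ ≫ joinMap θ' φ' := by
  refine SimplexCategory.Hom.ext _ _ (OrderHom.ext _ _ (funext fun i => Fin.ext ?_))
  obtain h | ⟨j, h⟩ := join_cases i
  · have h1 := joinMap_left θ φ i h
    have h2 : ((joinMap θ φ).toOrderHom i).1 < a'.len + 1 := by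
      rw [h1]; exact (θ.toOrderHom ⟨i.1, h⟩).2
    refine (joinMap_left _ _ i h).trans (Eq.symm ((joinMap_left θ' φ' _ h2).trans ?_))
    exact congrArg (fun x => (θ'.toOrderHom x).1) (Fin.ext h1)
  · have h1 := joinMap_right θ φ i j h
    exact (joinMap_right _ _ i j h).trans (joinMap_right θ' φ' _ _ h1).symm

lemma joinInr_joinMap {a a' b b' : SimplexCategory} (θ : a ⟶ a') (φ : b ⟶ b') :
    joinInr a b ≫ joinMap θ φ = φ ≫ joinInr a' b' := by
  refine SimplexCategory.Hom.ext _ _ (OrderHom.ext _ _ (funext fun j => Fin.ext ?_))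
  exact joinMap_right θ φ ((joinInr a b).toOrderHom j) j rfl

/-- The slice `X_{/σ}` over a simplex `σ : Δ[b] ⟶ X`: its `n`-simplices are the maps
`Δ[n] ⋆ Δ[b] = Δ[n + 1 + b] ⟶ X` that restrict to `σ` on `Δ[b]`. -/
def slice (X : SSet.{u}) {b : SimplexCategory} (σ : X.obj (op b)) : SSet.{u} where
  obj a := {τ : X.obj (op (join a.unop b)) // X.map (joinInr a.unop b).op τ = σ}
  map {a a'} θ := ↾fun τ => ⟨X.map (joinMap θ.unop (𝟙 b)).op τ.1, by
    rw [← Functor.map_comp_apply, ← op_comp, joinInr_joinMap, Category.id_comp, τ.2]⟩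
  map_id a := by
    ext τ
    simp [joinMap_id]
  map_comp θ θ' := by
    ext τ
    have h := joinMap_comp θ'.unop θ.unop (𝟙 b) (𝟙 b)
    rw [Category.id_comp] at h
    simp [h]

/-- The restriction `X_{/σ} ⟶ X_{/σ'}` when `σ'` is obtained from `σ` by restriction along
`φ : Δ[b'] ⟶ Δ[b]`. -/
def sliceRestrict (X : SSet.{u}) {b b' : SimplexCategory} (φ : b' ⟶ b) {σ : X.obj (op b)}
    {σ' : X.obj (op b')} (h : X.map φ.op σ = σ') : slice X σ ⟶ slice X σ' where
  app a := ↾fun τ => ⟨X.map (joinMap (𝟙 a.unop) φ).op τ.1, by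
    rw [← Functor.map_comp_apply, ← op_comp, joinInr_joinMap, op_comp,
      Functor.map_comp_apply, τ.2, h]⟩
  naturality a a' θ := by
    ext τ
    apply Subtype.ext
    change X.map _ (X.map _ τ.1) = X.map _ (X.map _ τ.1)
    rw [← Functor.map_comp_apply, ← Functor.map_comp_apply, ← op_comp, ← op_comp,
      ← joinMap_comp, ← joinMap_comp]
    simp

/-- The map `X_{/σ} ⟶ Y_{/p(σ)}` induced by a map of simplicial sets `p : X ⟶ Y`. -/
def sliceMap {X Y : SSet.{u}} (p : X ⟶ Y) {b : SimplexCategory} (σ : X.obj (op b)) :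
    slice X σ ⟶ slice Y (p.app (op b) σ) where
  app a := ↾fun τ => ⟨p.app _ τ.1, by rw [← NatTrans.naturality_apply, τ.2]⟩
  naturality a a' θ := by
    ext τ
    apply Subtype.ext
    exact NatTrans.naturality_apply p _ τ.1

/-- The target `y` of an edge `f : x ⟶ y`. -/
def target {X : SSet.{u}} (f : X _⦋1⦌) : X _⦋0⦌ := X.map (SimplexCategory.δ 0).op f

lemma target_app {X Y : SSet.{u}} (p : X ⟶ Y) (f : X _⦋1⦌) :
    target (p.app _ f) = p.app _ (target f) :=
  (NatTrans.naturality_apply p _ f).symm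

/-- For an edge `f : x ⟶ y` of `X` and `p : X ⟶ Y`, the natural map
`X_{/f} ⟶ X_{/y} ×_{Y_{/p(y)}} Y_{/p(f)}`. -/
noncomputable def comparison {X Y : SSet.{u}} (p : X ⟶ Y) (f : X _⦋1⦌) :
    slice X f ⟶ pullback (sliceMap p (target f))
      (sliceRestrict Y (SimplexCategory.δ 0) (target_app p f)) :=
  pullback.lift (sliceRestrict X (SimplexCategory.δ 0) rfl) (sliceMap p f) (by
    ext a τ
    apply Subtype.ext
    exact NatTrans.naturality_apply p _ τ.1)

/-- A map of simplicial sets is an acyclic Kan fibration if it has the right lifting property with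
respect to all boundary inclusions `∂Δ[n] ⟶ Δ[n]`, `n ≥ 0`. -/
def IsAcyclicKanFibration {X Y : SSet.{u}} (q : X ⟶ Y) : Prop :=
  ∀ n : ℕ, HasLiftingProperty (SSet.boundary.{u} n).ι q

/-- An edge `f : x ⟶ y` of `X` is `p`-cartesian if
`X_{/f} ⟶ X_{/y} ×_{Y_{/p(y)}} Y_{/p(f)}` is an acyclic Kan fibration. -/
def IsCartesian {X Y : SSet.{u}} (p : X ⟶ Y) (f : X _⦋1⦌) : Prop :=
  IsAcyclicKanFibration (comparison p f)

end SSetSlice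

/-! ### The span quasicategory -/

namespace SpanQuasi

/-- The poset of nonempty subintervals of `[a] = {0, …, a}`, with the reverse inclusion order,
regarded as a category. -/
abbrev Intervals (a : SimplexCategory) : Type := (NonemptyInterval (Fin (a.len + 1)))ᵒᵈ

/-- The underlying set of a subinterval. -/
def Intervals.toSet {a : SimplexCategory} (I : Intervals a) : Set (Fin (a.len + 1)) :=
  (OrderDual.ofDual I : NonemptyInterval (Fin (a.len + 1)))

/-- The subinterval `{i, …, j}`. -/
def Intervals.mk {a : SimplexCategory} (i j : Fin (a.len + 1)) (h : i ≤ j) : Intervals a :=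
  OrderDual.toDual ⟨(i, j), h⟩

/-- The functor on posets of subintervals induced by a monotone map `θ`; it takes `{i, …, j}` to
`{θ i, …, θ j}`. -/
def Intervals.functor {a b : SimplexCategory} (θ : a ⟶ b) : Intervals a ⥤ Intervals b :=
  Monotone.functor (f := fun I => OrderDual.toDual ((OrderDual.ofDual I).map θ.toOrderHom))
    (fun _ _ h => ⟨θ.toOrderHom.monotone h.1, θ.toOrderHom.monotone h.2⟩)

/-- The pullback property of a diagram indexed by subintervals: if `I` and `J` have nonempty
intersection `K` and union `U`, then `F U` is the pullback of `F I ⟶ F K ⟵ F J`. -/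
def PullbackProperty {C : Type u} [Category.{v} C] {a : SimplexCategory}
    (F : Intervals a ⥤ C) : Prop :=
  ∀ ⦃U I J K : Intervals a⦄ (i : U ⟶ I) (j : U ⟶ J) (k : I ⟶ K) (l : J ⟶ K),
    U.toSet = I.toSet ∪ J.toSet → K.toSet = I.toSet ∩ J.toSet →
      IsPullback (F.map i) (F.map j) (F.map k) (F.map l)

lemma Intervals.mem_toSet {a : SimplexCategory} (I : Intervals a) (x : Fin (a.len + 1)) :
    x ∈ I.toSet ↔ (OrderDual.ofDual I).fst ≤ x ∧ x ≤ (OrderDual.ofDual I).snd := Iff.rfl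

lemma toSet_functor {a b : SimplexCategory} (θ : a ⟶ b) {U I J K : Intervals a}
    (hU : U.toSet = I.toSet ∪ J.toSet) (hK : K.toSet = I.toSet ∩ J.toSet) :
    ((Intervals.functor θ).obj U).toSet =
        ((Intervals.functor θ).obj I).toSet ∪ ((Intervals.functor θ).obj J).toSet ∧
      ((Intervals.functor θ).obj K).toSet =
        ((Intervals.functor θ).obj I).toSet ∩ ((Intervals.functor θ).obj J).toSet := by
  obtain ⟨⟨u, u'⟩, hu⟩ := U
  obtain ⟨⟨i, i'⟩, hi⟩ := I
  obtain ⟨⟨j, j'⟩, hj⟩ := J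
  obtain ⟨⟨k, k'⟩, hk⟩ := K
  change u ≤ u' at hu
  change i ≤ i' at hi
  change j ≤ j' at hj
  change k ≤ k' at hk
  have hU' : ∀ x, (u ≤ x ∧ x ≤ u') ↔ ((i ≤ x ∧ x ≤ i') ∨ (j ≤ x ∧ x ≤ j')) := fun x =>
    Set.ext_iff.1 hU x
  have hK' : ∀ x, (k ≤ x ∧ x ≤ k') ↔ ((i ≤ x ∧ x ≤ i') ∧ (j ≤ x ∧ x ≤ j')) := fun x =>
    Set.ext_iff.1 hK x
  have hmono := θ.toOrderHom.monotone
  have hu1 : u = min i j := by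
    have := hU' u; have := hU' i; have := hU' j; grind
  have hu2 : u' = max i' j' := by
    have := hU' u'; have := hU' i'; have := hU' j'; grind
  have hk1 : k = max i j := by
    have := hK' k; have := hK' i; have := hK' j; grind
  have hk2 : k' = min i' j' := by
    have := hK' k'; have := hK' i'; have := hK' j'; grind
  have e1 := hmono.map_min (a := i) (b := j)
  have e2 := hmono.map_max (a := i') (b := j')
  have e3 := hmono.map_max (a := i) (b := j)
  have e4 := hmono.map_min (a := i') (b := j')
  have e5 := hmono hk
  rw [← hu1] at e1
  rw [← hu2] at e2
  rw [← hk1] at e3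
  rw [← hk2] at e4
  refine ⟨Set.ext fun x => ?_, Set.ext fun x => ?_⟩
  · change (θ.toOrderHom u ≤ x ∧ x ≤ θ.toOrderHom u') ↔
      ((θ.toOrderHom i ≤ x ∧ x ≤ θ.toOrderHom i') ∨ (θ.toOrderHom j ≤ x ∧ x ≤ θ.toOrderHom j'))
    grind
  · change (θ.toOrderHom k ≤ x ∧ x ≤ θ.toOrderHom k') ↔
      ((θ.toOrderHom i ≤ x ∧ x ≤ θ.toOrderHom i') ∧ (θ.toOrderHom j ≤ x ∧ x ≤ θ.toOrderHom j'))
    grind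

/-- The simplicial set `Span(C)`: its `n`-simplices are the functors from the poset of nonempty
subintervals of `[n]` to `C` that have the pullback property. -/
def Span (C : Type u) [Category.{v} C] : SSet.{max u v} where
  obj a := {F : Intervals a.unop ⥤ C // PullbackProperty F}
  map θ := ↾fun F => ⟨Intervals.functor θ.unop ⋙ F.1, fun _ _ _ _ _ _ _ _ hU hK =>
    F.2 _ _ _ _ (toSet_functor θ.unop hU hK).1
      (toSet_functor θ.unop hU hK).2⟩
  map_id _ := rfl
  map_comp _ _ := rfl

/-- The map `Span(C) ⟶ Span(D)` induced by a functor `C ⥤ D` that preserves pullbacks. -/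
def Span.map {C : Type u} [Category.{v} C] {D : Type u} [Category.{v} D]
    (G : C ⥤ D)
    [PreservesLimitsOfShape WalkingCospan G] : Span C ⟶ Span D where
  app _ := ↾fun F => ⟨F.1 ⋙ G, fun _ _ _ _ i j k l hU hK => (F.2 i j k l hU hK).map G⟩
  naturality _ _ _ := rfl

instance : PreservesLimitsOfShape WalkingCospan
    (Arrow.rightFunc : Arrow FintypeCat.{u} ⥤ FintypeCat.{u}) where
  preservesLimit :=
    preservesLimit_of_preserves_limit_cone
      (Comma.coneOfPreservesIsLimit _ (limit.isLimit _) (limit.isLimit _))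
      (limit.isLimit _)

/-- `Span = Span(FinSet)`. -/
abbrev SpanFin : SSet.{u + 1} := Span FintypeCat.{u}

/-- `Span^× = Span(Arr(FinSet))`. -/
abbrev SpanTimes : SSet.{u + 1} := Span (Arrow FintypeCat.{u})

/-- The projection `Span^× ⟶ Span` induced by the codomain functor
`Arr(FinSet) ⥤ FinSet`, `(X ⟶ Y) ↦ Y`. -/
def proj : SpanTimes.{u} ⟶ SpanFin.{u} := Span.map Arrow.rightFunc

section Edge

variable {C : Type u} [Category.{v} C] (F : Span C _⦋1⦌)

/-- The source `F₀` of an edge `F₀ ⟵ F₀₁ ⟶ F₁` of `Span(C)`. -/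
def edgeSource : C := F.1.obj (Intervals.mk (a := ⦋1⦌) 0 0 le_rfl)

/-- The apex `F₀₁` of an edge `F₀ ⟵ F₀₁ ⟶ F₁` of `Span(C)`. -/
def edgeApex : C := F.1.obj (Intervals.mk (a := ⦋1⦌) 0 1 (Fin.zero_le _))

/-- The target `F₁` of an edge `F₀ ⟵ F₀₁ ⟶ F₁` of `Span(C)`. -/
def edgeTarget : C := F.1.obj (Intervals.mk (a := ⦋1⦌) 1 1 le_rfl)

/-- The left leg `λ₀₁ : F₀₁ ⟶ F₀`. -/
def edgeLeft : edgeApex F ⟶ edgeSource F :=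
  F.1.map (homOfLE ⟨le_rfl, Fin.zero_le _⟩)

/-- The right leg `ρ₀₁ : F₀₁ ⟶ F₁`. -/
def edgeRight : edgeApex F ⟶ edgeTarget F :=
  F.1.map (homOfLE ⟨Fin.zero_le _, le_rfl⟩)

end Edge

end SpanQuasi

/-! Let δ be the inclusion of `[n] ⋆ [0]` in `[n] ⋆ [1]` that omits the source of the last edge, and
r its retraction, which sends both ends of that edge to the last vertex. An n-simplex of the target
of the comparison map gives a diagram on the last face, with domains X, and a base diagram Y on all
intervals.

Suppose that the right square of F is a pullback and its left leg is invertible on domains. Then the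
domains of a filler are forced up to isomorphism. If I ends at the source of the last edge, the
pullback property makes the map from the enlarged interval I⁺ to I a base change of the left leg,
hence invertible; on the last edge itself, the right square determines the domain. Both cases are
covered by the formula X(rI) ×_{Y(δrI)} Y(I⁺) of `cartLift`.

Simplices are strict functors, so `cartLift` is conjugated by chosen isomorphisms until it restricts
to the given data on the nose (`transport`). The only choices left are, for each vertex x of `[n]`,
a value at {x, …, source of the last edge} with an isomorphism to the forced one. Hence fillers
exist with any admissible lifts of the vertices (`exists_filler`) and are determined by these
(`eq_of_vertexJoin`), which yields the lifting property (`isAcyclicKanFibration_of_vertices`).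

Conversely, a cartesian F is compared with a lift F' of the same base edge with the same target and
the required shape (`exists_rightSquare_lift`), which is cartesian by the first half. The usual
uniqueness argument gives 2-simplices between F and F' in both directions, and 3-simplices show that
their first edges are mutually inverse. An invertible span has invertible legs
(`isIso_edge_of_inverse`), and F, a composite of such a span with F', inherits both properties of
F'. -/

namespace SpanQuasi

/-! ### Diagrams of arrows, and replacing the values of a functor by isomorphic ones. -/

section ArrowFunctor

variable {J : Type u'} [Category.{v'} J] {C : Type u} [Category.{v} C]

/-- The functor to the arrow category given by a natural transformation. -/
@[simps]
def arrowFunctor {X Y : J ⥤ C} (π : X ⟶ Y) : J ⥤ Arrow C where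
  obj I := Arrow.mk (π.app I)
  map f := Arrow.homMk (X.map f) (Y.map f) (π.naturality f)

lemma exists_arrowFunctor (H : J ⥤ Arrow C) {Y : J ⥤ C} (h : H ⋙ Arrow.rightFunc = Y) :
    ∃ (X : J ⥤ C) (π : X ⟶ Y), H = arrowFunctor π := by
  subst h
  exact ⟨H ⋙ Arrow.leftFunc, Functor.whiskerLeft H Arrow.leftToRight, rfl⟩

lemma arrowFunctor_congr {X X' Y : J ⥤ C} (h : X = X') (π : X ⟶ Y) (π' : X' ⟶ Y)
    (hπ : π = eqToHom h ≫ π') : arrowFunctor π = arrowFunctor π' := by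
  subst h
  simp at hπ
  rw [hπ]

/-- A functor transported along isomorphisms of its values. -/
@[simps]
def transport (P : J ⥤ C) (s : ∀ I, Σ Z : C, Z ≅ P.obj I) : J ⥤ C where
  obj I := (s I).1
  map {I I'} f := (s I).2.hom ≫ P.map f ≫ (s I').2.inv

/-- The isomorphism from a transported functor to the given one. -/
def transportIso (P : J ⥤ C) (s : ∀ I, Σ Z : C, Z ≅ P.obj I) : transport P s ≅ P :=
  NatIso.ofComponents (fun I => (s I).2) (fun f => by simp [transport])

/-- Naturality of α says that conjugating the maps of P by its components gives back the maps of N,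
so the two functors are equal and not merely isomorphic. -/
lemma transport_eq (P : J ⥤ C) (N : J ⥤ C) (α : N ≅ P) :
    transport P (fun I => ⟨N.obj I, α.app I⟩) = N :=
  CategoryTheory.Functor.ext (fun _ => rfl) (fun I I' f => by
    simp [transport]; exact (Category.id_comp _).symm)

lemma arrowFunctor_transport_eq {P Y N : J ⥤ C} (τ : P ⟶ Y) (α : N ≅ P) :
    arrowFunctor ((transportIso P (fun I => ⟨N.obj I, α.app I⟩)).hom ≫ τ) =
      arrowFunctor (α.hom ≫ τ) := by
  refine arrowFunctor_congr (transport_eq P N α) _ _ ?_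
  ext I
  rw [NatTrans.comp_app, NatTrans.comp_app, eqToHom_app]
  exact (Category.id_comp _).symm

/-- This turns an isomorphism of restrictions into an equality: it suffices to choose the values on
the image of ι to be those of N. -/
lemma comp_arrowFunctor_transport {J' : Type*} [Category J'] {P Y : J ⥤ C} (τ : P ⟶ Y)
    (s : ∀ I, Σ Z : C, Z ≅ P.obj I) (ι : J' ⥤ J) {N : J' ⥤ C} (α : N ≅ ι ⋙ P)
    (hs : ∀ I, s (ι.obj I) = ⟨N.obj I, α.app I⟩) :
    ι ⋙ arrowFunctor ((transportIso P s).hom ≫ τ) =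
      arrowFunctor (α.hom ≫ Functor.whiskerLeft ι τ) := by
  rw [← arrowFunctor_transport_eq (Functor.whiskerLeft ι τ) α]
  have : (fun I => s (ι.obj I)) = (fun I => ⟨N.obj I, α.app I⟩) := funext hs
  rw [← this]
  rfl

end ArrowFunctor

/-! ### Pullback squares of arrows and of functors. -/

section IsPullback

variable {C : Type u} [Category.{v} C]

/-- Limits of arrows are computed on domains and codomains; the two induced maps form a square
because maps into the codomain pullback are tested on its projections. -/
lemma isPullback_arrow {U I J K : Arrow C} {i : U ⟶ I} {j : U ⟶ J} {k : I ⟶ K} {l : J ⟶ K}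
    (hl : IsPullback i.left j.left k.left l.left)
    (hr : IsPullback i.right j.right k.right l.right) : IsPullback i j k l where
  w := by ext; exacts [hl.w, hr.w]
  isLimit' := ⟨PullbackCone.IsLimit.mk _
    (fun s => Arrow.homMk
      (hl.lift s.fst.left s.snd.left (congrArg CommaMorphism.left s.condition))
      (hr.lift s.fst.right s.snd.right (congrArg CommaMorphism.right s.condition))
      (hr.hom_ext
        ((Category.assoc _ _ _).trans <| (congrArg (_ ≫ ·) (Arrow.w i).symm).trans <|
          (hl.lift_fst_assoc _ _ _ _).trans <| (Arrow.w s.fst).trans <|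
          (congrArg (_ ≫ ·) (hr.lift_fst _ _ _).symm).trans (Category.assoc _ _ _).symm)
        ((Category.assoc _ _ _).trans <| (congrArg (_ ≫ ·) (Arrow.w j).symm).trans <|
          (hl.lift_snd_assoc _ _ _ _).trans <| (Arrow.w s.snd).trans <|
          (congrArg (_ ≫ ·) (hr.lift_snd _ _ _).symm).trans (Category.assoc _ _ _).symm)))
    (fun s => Arrow.hom_ext _ _ (hl.lift_fst _ _ _) (hr.lift_fst _ _ _))
    (fun s => Arrow.hom_ext _ _ (hl.lift_snd _ _ _) (hr.lift_snd _ _ _))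
    (fun s m h1 h2 => Arrow.hom_ext _ _
      (hl.hom_ext ((congrArg CommaMorphism.left h1).trans (hl.lift_fst _ _ _).symm)
        ((congrArg CommaMorphism.left h2).trans (hl.lift_snd _ _ _).symm))
      (hr.hom_ext ((congrArg CommaMorphism.right h1).trans (hr.lift_fst _ _ _).symm)
        ((congrArg CommaMorphism.right h2).trans (hr.lift_snd _ _ _).symm)))⟩

instance [HasPullbacks C] : PreservesLimitsOfShape WalkingCospan
    (Arrow.leftFunc : Arrow C ⥤ C) where
  preservesLimit :=
    preservesLimit_of_preserves_limit_cone
      (Comma.coneOfPreservesIsLimit _ (limit.isLimit _) (limit.isLimit _))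
      (limit.isLimit _)

/-- A pullback of pullback squares is a pullback square. -/
lemma isPullback_of_isPullback {J : Type u'} [Category.{v'} J] {P X Y Z : J ⥤ C}
    {p : P ⟶ X} {q : P ⟶ Y} {f : X ⟶ Z} {g : Y ⟶ Z}
    (h : ∀ I, IsPullback (p.app I) (q.app I) (f.app I) (g.app I))
    {U I J' K : J} {i : U ⟶ I} {j : U ⟶ J'} {k : I ⟶ K} {l : J' ⟶ K} (w : i ≫ k = j ≫ l)
    (hX : IsPullback (X.map i) (X.map j) (X.map k) (X.map l))
    (hY : IsPullback (Y.map i) (Y.map j) (Y.map k) (Y.map l))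
    (hZ : IsPullback (Z.map i) (Z.map j) (Z.map k) (Z.map l)) :
    IsPullback (P.map i) (P.map j) (P.map k) (P.map l) where
  w := by rw [← P.map_comp, w, P.map_comp]
  isLimit' := ⟨PullbackCone.IsLimit.mk _
    (fun s => (h U).lift
      (hX.lift (s.fst ≫ p.app I) (s.snd ≫ p.app J') (by
        rw [Category.assoc, ← p.naturality, s.condition_assoc, p.naturality, Category.assoc]))
      (hY.lift (s.fst ≫ q.app I) (s.snd ≫ q.app J') (by
        rw [Category.assoc, ← q.naturality, s.condition_assoc, q.naturality, Category.assoc]))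
      (hZ.hom_ext
        (by simp only [Category.assoc, ← f.naturality, ← g.naturality, IsPullback.lift_fst_assoc,
          (h I).w])
        (by simp only [Category.assoc, ← f.naturality, ← g.naturality, IsPullback.lift_snd_assoc,
          (h J').w])))
    (fun s => (h I).hom_ext
      (by rw [Category.assoc, p.naturality i, (h U).lift_fst_assoc, hX.lift_fst])
      (by rw [Category.assoc, q.naturality i, (h U).lift_snd_assoc, hY.lift_fst]))
    (fun s => (h J').hom_ext
      (by rw [Category.assoc, p.naturality j, (h U).lift_fst_assoc, hX.lift_snd])
      (by rw [Category.assoc, q.naturality j, (h U).lift_snd_assoc, hY.lift_snd]))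
    (fun s m h1 h2 => (h U).hom_ext
      (hX.hom_ext
        (by rw [Category.assoc, ← p.naturality, reassoc_of% h1, (h U).lift_fst, hX.lift_fst])
        (by rw [Category.assoc, ← p.naturality, reassoc_of% h2, (h U).lift_fst, hX.lift_snd]))
      (hY.hom_ext
        (by rw [Category.assoc, ← q.naturality, reassoc_of% h1, (h U).lift_snd, hY.lift_fst])
        (by rw [Category.assoc, ← q.naturality, reassoc_of% h2, (h U).lift_snd, hY.lift_snd])))⟩

end IsPullback

/-! ### Ends of intervals, and extension to the right. -/

namespace Intervals

variable {a b c : SimplexCategory}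

/-- The left end of an interval. -/
def lo (I : Intervals a) : Fin (a.len + 1) := (OrderDual.ofDual I).fst

/-- The right end of an interval. -/
def hi (I : Intervals a) : Fin (a.len + 1) := (OrderDual.ofDual I).snd

lemma lo_le_hi (I : Intervals a) : I.lo ≤ I.hi := (OrderDual.ofDual I).fst_le_snd

lemma le_iff {I J : Intervals a} : I ≤ J ↔ I.lo ≤ J.lo ∧ J.hi ≤ I.hi := Iff.rfl

lemma ext {I J : Intervals a} (h1 : I.lo = J.lo) (h2 : I.hi = J.hi) : I = J :=
  le_antisymm (le_iff.2 ⟨h1.le, h2.ge⟩) (le_iff.2 ⟨h1.ge, h2.le⟩)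

@[simp] lemma hi_functor (θ : a ⟶ b) (I : Intervals a) :
    ((functor θ).obj I).hi = θ.toOrderHom I.hi := rfl

lemma toSet_eq (I : Intervals a) : I.toSet = Set.Icc I.lo I.hi := rfl

/-- Unions and intersections of intervals in terms of their ends. -/
lemma ends_of_union_inter {U I J K : Intervals a} (hU : U.toSet = I.toSet ∪ J.toSet)
    (hK : K.toSet = I.toSet ∩ J.toSet) :
    U.lo = min I.lo J.lo ∧ U.hi = max I.hi J.hi ∧ K.lo = max I.lo J.lo ∧ K.hi = min I.hi J.hi := by
  have hU' : ∀ x, (U.lo ≤ x ∧ x ≤ U.hi) ↔ ((I.lo ≤ x ∧ x ≤ I.hi) ∨ (J.lo ≤ x ∧ x ≤ J.hi)) :=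
    fun x => Set.ext_iff.1 hU x
  have hK' : ∀ x, (K.lo ≤ x ∧ x ≤ K.hi) ↔ ((I.lo ≤ x ∧ x ≤ I.hi) ∧ (J.lo ≤ x ∧ x ≤ J.hi)) :=
    fun x => Set.ext_iff.1 hK x
  have := U.lo_le_hi
  have := I.lo_le_hi
  have := J.lo_le_hi
  have := K.lo_le_hi
  refine ⟨?_, ?_, ?_, ?_⟩
  · have := hU' U.lo; have := hU' I.lo; have := hU' J.lo; grind
  · have := hU' U.hi; have := hU' I.hi; have := hU' J.hi; grind
  · have := hK' K.lo; have := hK' I.lo; have := hK' J.lo; grind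
  · have := hK' K.hi; have := hK' I.hi; have := hK' J.hi; grind

lemma union_of_ends {U I J K : Intervals a} (hU1 : U.lo = min I.lo J.lo)
    (hU2 : U.hi = max I.hi J.hi) (hK1 : K.lo = max I.lo J.lo) (hK2 : K.hi = min I.hi J.hi) :
    U.toSet = I.toSet ∪ J.toSet ∧ K.toSet = I.toSet ∩ J.toSet := by
  have := U.lo_le_hi
  have := I.lo_le_hi
  have := J.lo_le_hi
  have := K.lo_le_hi
  refine ⟨Set.ext fun x => ?_, Set.ext fun x => ?_⟩
  · simp only [toSet_eq, Set.mem_union, Set.mem_Icc]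
    grind
  · simp only [toSet_eq, Set.mem_inter_iff, Set.mem_Icc]
    grind

/-- The endofunctor `{i, …, j} ↦ {i, …, e j}` for an inflationary map `e`. -/
def extend (e : a ⟶ a) (he : ∀ x, x ≤ e.toOrderHom x) : Intervals a ⥤ Intervals a :=
  Monotone.functor (f := fun I => mk I.lo (e.toOrderHom I.hi) (I.lo_le_hi.trans (he _)))
    (fun _ _ h => le_iff.2 ⟨h.1, e.toOrderHom.monotone h.2⟩)

variable (e : a ⟶ a) (he : ∀ x, x ≤ e.toOrderHom x)

@[simp] lemma lo_extend (I : Intervals a) : ((extend e he).obj I).lo = I.lo := rfl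
@[simp] lemma hi_extend (I : Intervals a) : ((extend e he).obj I).hi = e.toOrderHom I.hi := rfl

/-- An interval is contained in its extension. -/
def extendTo : extend e he ⟶ 𝟭 _ where
  app I := homOfLE (le_iff.2 ⟨le_rfl, he _⟩)

/-- Left ends do not move, and a monotone map commutes with the maximum and minimum of right ends.
-/
lemma toSet_extend {U I J K : Intervals a} (hU : U.toSet = I.toSet ∪ J.toSet)
    (hK : K.toSet = I.toSet ∩ J.toSet) :
    ((extend e he).obj U).toSet = ((extend e he).obj I).toSet ∪ ((extend e he).obj J).toSet ∧
      ((extend e he).obj K).toSet =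
        ((extend e he).obj I).toSet ∩ ((extend e he).obj J).toSet := by
  obtain ⟨h1, h2, h3, h4⟩ := ends_of_union_inter hU hK
  refine union_of_ends h1 ?_ h3 ?_
  · simp [h2, e.toOrderHom.monotone.map_max]
  · simp [h4, e.toOrderHom.monotone.map_min]

end Intervals

end SpanQuasi

namespace SpanQuasi

open Functor

/-! ### Stability of the pullback property. -/

section PullbackProperty

variable {a b : SimplexCategory} {C : Type u} [Category.{v} C]

lemma PullbackProperty.of_iso {F G : Intervals a ⥤ C} (hF : PullbackProperty F) (e : F ≅ G) :
    PullbackProperty G := fun _ _ _ _ i j k l hU hK =>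
  (hF i j k l hU hK).of_iso (e.app _) (e.app _) (e.app _) (e.app _) (by simp) (by simp) (by simp)
    (by simp)

lemma PullbackProperty.comp_functor {F : Intervals b ⥤ C} (hF : PullbackProperty F) (θ : a ⟶ b) :
    PullbackProperty (Intervals.functor θ ⋙ F) := fun _ _ _ _ _ _ _ _ hU hK =>
  hF _ _ _ _ (toSet_functor θ hU hK).1 (toSet_functor θ hU hK).2

lemma PullbackProperty.comp_extend {F : Intervals a ⥤ C} (hF : PullbackProperty F) (e : a ⟶ a)
    (he : ∀ x, x ≤ e.toOrderHom x) :
    PullbackProperty (Intervals.extend e he ⋙ F) := fun _ _ _ _ _ _ _ _ hU hK =>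
  hF _ _ _ _ (Intervals.toSet_extend e he hU hK).1 (Intervals.toSet_extend e he hU hK).2

lemma PullbackProperty.comp {F : Intervals a ⥤ C} (hF : PullbackProperty F) {D : Type u'}
    [Category.{v'} D] (G : C ⥤ D) [PreservesLimitsOfShape WalkingCospan G] :
    PullbackProperty (F ⋙ G) :=
  fun _ _ _ _ i j k l hU hK => (hF i j k l hU hK).map G

lemma pullbackProperty_arrowFunctor {X Y : Intervals a ⥤ C} (π : X ⟶ Y)
    (hX : PullbackProperty X) (hY : PullbackProperty Y) : PullbackProperty (arrowFunctor π) :=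
  fun _ _ _ _ i j k l hU hK => isPullback_arrow (hX i j k l hU hK) (hY i j k l hU hK)

end PullbackProperty

/-! ### The universal extension of a diagram along a retract. -/

section CartLift

variable {a c : SimplexCategory} (δ : c ⟶ a) (r : a ⟶ c) (hr : ∀ x, x ≤ (r ≫ δ).toOrderHom x)
  {X : Intervals c ⥤ FintypeCat.{u}} {Y : Intervals a ⥤ FintypeCat.{u}}
  (π : X ⟶ Intervals.functor δ ⋙ Y)

/-- The image of an interval is contained in its extension. -/
def extendRes : Intervals.extend (r ≫ δ) hr ⟶ Intervals.functor r ⋙ Intervals.functor δ where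
  app I := homOfLE (Intervals.le_iff.2 ⟨hr _, le_rfl⟩)

/-- The functor `I ↦ X (r I) ×_{Y (δ r I)} Y (I⁺)`, where `I⁺` is the extension of `I` along
`δ r`. -/
noncomputable def cartLift : Intervals a ⥤ FintypeCat.{u} :=
  pullback (whiskerLeft (Intervals.functor r) π)
    (whiskerRight (extendRes δ r hr) Y)

/-- The first projection of `cartLift`. -/
noncomputable def cartFst : cartLift δ r hr π ⟶ Intervals.functor r ⋙ X := pullback.fst _ _

/-- The second projection of `cartLift`. -/
noncomputable def cartSnd : cartLift δ r hr π ⟶ Intervals.extend (r ≫ δ) hr ⋙ Y :=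
  pullback.snd _ _

lemma isPullback_cartLift (I : Intervals a) :
    IsPullback ((cartFst δ r hr π).app I) ((cartSnd δ r hr π).app I)
      (π.app ((Intervals.functor r).obj I)) (Y.map ((extendRes δ r hr).app I)) :=
  (IsPullback.of_hasPullback (whiskerLeft (Intervals.functor r) π)
    (whiskerRight (extendRes δ r hr) Y)).app I

/-- The map from `cartLift` to the base. -/
noncomputable def cartProj : cartLift δ r hr π ⟶ Y :=
  cartSnd δ r hr π ≫ whiskerRight (Intervals.extendTo (r ≫ δ) hr) Y

lemma cartProj_app (I : Intervals a) :
    (cartProj δ r hr π).app I =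
      (cartSnd δ r hr π).app I ≫ Y.map ((Intervals.extendTo (r ≫ δ) hr).app I) := rfl

/-- The three corners of the defining cospan have the property, since restriction and extension of
intervals preserve the relevant unions and intersections; limits commute with limits. -/
lemma pullbackProperty_cartLift (hX : PullbackProperty X) (hY : PullbackProperty Y) :
    PullbackProperty (cartLift δ r hr π) := fun _ _ _ _ i j k l hU hK =>
  isPullback_of_isPullback
    (f := whiskerLeft (Intervals.functor r) π)
    (g := whiskerRight (extendRes δ r hr) Y)
    (isPullback_cartLift δ r hr π) (Subsingleton.elim _ _)
    (hX.comp_functor r i j k l hU hK) (hY.comp_extend _ hr i j k l hU hK)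
    ((hY.comp_functor δ).comp_functor r i j k l hU hK)

lemma isIso_map_of_eq {J : Type*} [PartialOrder J] {C : Type u} [Category.{v} C] (F : J ⥤ C)
    {I I' : J} (f : I ⟶ I') (h : I = I') : IsIso (F.map f) := by
  subst h
  rw [Subsingleton.elim f (𝟙 _)]
  infer_instance

/-- The value at I depends only on rI and I⁺, and the hypotheses say that f changes neither. -/
lemma isIso_cartLift_map {I I' : Intervals a} (f : I ⟶ I')
    (h1 : r.toOrderHom I.lo = r.toOrderHom I'.lo) (h2 : r.toOrderHom I.hi = r.toOrderHom I'.hi)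
    (h3 : I.lo = I'.lo) : IsIso ((cartLift δ r hr π).map f) := by
  have := isIso_map_of_eq X ((Intervals.functor r).map f) (Intervals.ext h1 h2)
  have := isIso_map_of_eq Y ((Intervals.functor δ).map ((Intervals.functor r).map f))
    (Intervals.ext (congrArg δ.toOrderHom h1) (congrArg δ.toOrderHom h2))
  have := isIso_map_of_eq Y ((Intervals.extend (r ≫ δ) hr).map f)
    (Intervals.ext h3 (congrArg δ.toOrderHom h2))
  have h := (isPullback_cartLift δ r hr π I).of_iso (Iso.refl _)
    (asIso (X.map ((Intervals.functor r).map f)))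
    (asIso (Y.map ((Intervals.extend (r ≫ δ) hr).map f)))
    (asIso (Y.map ((Intervals.functor δ).map ((Intervals.functor r).map f))))
    (fst' := (cartLift δ r hr π).map f ≫ (cartFst δ r hr π).app I')
    (snd' := (cartLift δ r hr π).map f ≫ (cartSnd δ r hr π).app I')
    (f' := π.app ((Intervals.functor r).obj I'))
    (g' := Y.map ((extendRes δ r hr).app I'))
    ((Category.id_comp _).trans ((cartFst δ r hr π).naturality f)).symm
    ((Category.id_comp _).trans ((cartSnd δ r hr π).naturality f)).symm
    (π.naturality ((Intervals.functor r).map f)).symm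
    (whiskerRight (extendRes δ r hr) Y |>.naturality f).symm
  have e : (cartLift δ r hr π).map f =
      (h.isoIsPullback _ _ (isPullback_cartLift δ r hr π I')).hom :=
    (isPullback_cartLift δ r hr π I').hom_ext (by simp) (by simp)
  rw [e]
  infer_instance

variable (hδ : δ ≫ r = 𝟙 c)

include hδ in
lemma retract_apply (x : Fin (c.len + 1)) : r.toOrderHom (δ.toOrderHom x) = x :=
  congrArg (fun f : c ⟶ c => f.toOrderHom x) hδ

/-- An interval is its own restriction. -/
def toRes (J : Intervals c) : J ⟶ (Intervals.functor r).obj ((Intervals.functor δ).obj J) :=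
  homOfLE (Intervals.le_iff.2 ⟨(retract_apply δ r hδ _).ge, (retract_apply δ r hδ _).le⟩)

/-- An interval of the retract is its own extension. -/
def toExtend (J : Intervals c) : (Intervals.functor δ).obj J ⟶
    (Intervals.extend (r ≫ δ) hr).obj ((Intervals.functor δ).obj J) :=
  homOfLE (Intervals.le_iff.2
    ⟨le_rfl, (congrArg δ.toOrderHom (retract_apply δ r hδ J.hi)).le⟩)

/-- The components of the comparison of `X` with the restriction of `cartLift`. -/
noncomputable def toCartLiftApp (J : Intervals c) :
    X.obj J ⟶ (cartLift δ r hr π).obj ((Intervals.functor δ).obj J) :=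
  (isPullback_cartLift δ r hr π ((Intervals.functor δ).obj J)).lift
    (X.map (toRes δ r hδ J)) (π.app J ≫ Y.map (toExtend δ r hr hδ J))
    (by
      rw [π.naturality, Category.assoc, Functor.comp_map, ← Y.map_comp]
      rfl)

lemma toCartLiftApp_fst (J : Intervals c) :
    toCartLiftApp δ r hr π hδ J ≫ (cartFst δ r hr π).app _ = X.map (toRes δ r hδ J) :=
  IsPullback.lift_fst _ _ _ _

lemma toCartLiftApp_snd (J : Intervals c) :
    toCartLiftApp δ r hr π hδ J ≫ (cartSnd δ r hr π).app _ =
      π.app J ≫ Y.map (toExtend δ r hr hδ J) :=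
  IsPullback.lift_snd _ _ _ _

/-- The comparison of `X` with the restriction of `cartLift`. -/
noncomputable def toCartLift : X ⟶ Intervals.functor δ ⋙ cartLift δ r hr π where
  app J := toCartLiftApp δ r hr π hδ J
  naturality J J' f := (isPullback_cartLift δ r hr π ((Intervals.functor δ).obj J')).hom_ext
    (by
      have := (cartFst δ r hr π).naturality ((Intervals.functor δ).map f)
      simp only [Functor.comp_map] at this ⊢
      rw [Category.assoc, Category.assoc, toCartLiftApp_fst, this,
        reassoc_of% (toCartLiftApp_fst δ r hr π hδ J),
        ← X.map_comp, ← X.map_comp]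
      rfl)
    (by
      have := (cartSnd δ r hr π).naturality ((Intervals.functor δ).map f)
      simp only [Functor.comp_map] at this ⊢
      rw [Category.assoc, Category.assoc, toCartLiftApp_snd, this,
        reassoc_of% (toCartLiftApp_snd δ r hr π hδ J),
        π.naturality_assoc, Functor.comp_map, ← Y.map_comp, ← Y.map_comp]
      rfl)

/-- An interval in the image of δ is its own extension, so there the second leg of the defining
cospan is invertible and the fibre product collapses to X. -/
instance isIso_toCartLift : IsIso (toCartLift δ r hr π hδ) := by
  rw [NatTrans.isIso_iff_isIso_app]
  intro J
  have e (x) : δ.toOrderHom (r.toOrderHom (δ.toOrderHom x)) = δ.toOrderHom x :=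
    congrArg δ.toOrderHom (retract_apply δ r hδ x)
  have := isIso_map_of_eq X (toRes δ r hδ J) (Intervals.ext (retract_apply δ r hδ _).symm
    (retract_apply δ r hδ _).symm)
  have := isIso_map_of_eq Y ((extendRes δ r hr).app ((Intervals.functor δ).obj J))
    (Intervals.ext (e _).symm rfl)
  have h := (isPullback_cartLift δ r hr π ((Intervals.functor δ).obj J))
  have : IsIso ((cartFst δ r hr π).app ((Intervals.functor δ).obj J)) := h.isIso_fst_of_isIso
  have h3 := toCartLiftApp_fst δ r hr π hδ J
  rw [← IsIso.eq_comp_inv] at h3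
  change IsIso (toCartLiftApp δ r hr π hδ J)
  rw [h3]
  infer_instance

lemma toCartLift_proj :
    toCartLift δ r hr π hδ ≫ whiskerLeft (Intervals.functor δ) (cartProj δ r hr π) = π := by
  ext J : 2
  rw [NatTrans.comp_app, whiskerLeft_app, cartProj_app]
  change toCartLiftApp δ r hr π hδ J ≫ _ = _
  rw [reassoc_of% (toCartLiftApp_snd δ r hr π hδ J), ← Y.map_comp,
    Subsingleton.elim (toExtend δ r hr hδ J ≫ _) (𝟙 _), Y.map_id]
  exact Category.comp_id _

end CartLift

end SpanQuasi

/-! ### Comparison of the universal extension with the last edge, and gluing of chosen values. -/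

namespace SpanQuasi

open Functor

/-- Compatibility is heterogeneous because two labels may give the same index only propositionally.
Off the range of I an arbitrary element serves. -/
lemma exists_section {J : Type*} {T : J → Type*} [∀ I, Nonempty (T I)] {ι : Type*} (I : ι → J)
    (t : ∀ i, T (I i)) (h : ∀ i j, I i = I j → t i ≍ t j) : ∃ s : ∀ I, T I, ∀ i, s (I i) = t i := by
  classical
  refine ⟨fun j => if hj : ∃ i, I i = j then hj.choose_spec ▸ t hj.choose else Classical.arbitrary _,
    fun i => ?_⟩
  have hi : ∃ i', I i' = I i := ⟨i, rfl⟩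
  simp only [dif_pos hi]
  exact eq_of_heq ((eqRec_heq _ _).trans (h _ _ hi.choose_spec))

lemma sigma_iso_heq {J : Type*} [PartialOrder J] {C : Type u} [Category.{v} C] (P : J ⥤ C)
    {I I' : J} (f : I ⟶ I') (hI : I = I') {Z Z' : C} (e : Z ≅ P.obj I) (e' : Z' ≅ P.obj I')
    (h : Z = Z') (he : e.hom ≫ P.map f = eqToHom h ≫ e'.hom) :
    (⟨Z, e⟩ : Σ Z : C, Z ≅ P.obj I) ≍ (⟨Z', e'⟩ : Σ Z : C, Z ≅ P.obj I') := by
  subst hI h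
  rw [Subsingleton.elim f (𝟙 _)] at he
  have : e = e' := Iso.ext (by simpa using he)
  rw [this]

lemma one_le_apply (x : Fin ((⦋1⦌ : SimplexCategory).len + 1)) :
    1 ≤ (SimplexCategory.σ (n := 0) 0 ≫ SimplexCategory.δ 0).toOrderHom x := by
  revert x
  change ∀ x : Fin 2, _
  decide

/-- The endofunctor `{i, …, j} ↦ {i, …, 1}` on intervals of `[1]`. -/
abbrev extendOne : Intervals ⦋1⦌ ⥤ Intervals ⦋1⦌ :=
  Intervals.extend (SimplexCategory.σ (n := 0) 0 ≫ SimplexCategory.δ 0)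
    (fun x => (Fin.le_last x).trans (one_le_apply x))

/-- An interval is contained in its extension. -/
abbrev extendOneTo : extendOne ⟶ 𝟭 _ := Intervals.extendTo _ _

/-- The interval `{1}` of `[1]`. -/
abbrev lastOne : Intervals ⦋1⦌ := Intervals.mk (a := ⦋1⦌) 1 1 le_rfl

/-- The map from the extension of an interval to the last vertex. -/
def extendOneRes (I : Intervals ⦋1⦌) : extendOne.obj I ⟶ lastOne :=
  homOfLE (Intervals.le_iff.2 ⟨Fin.le_last _, one_le_apply _⟩)

/-- A vertex, as an interval. -/
abbrev Intervals.point {c : SimplexCategory} (k : Fin (c.len + 1)) : Intervals c := mk k k le_rfl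

section LastEdge

variable {a c : SimplexCategory} (δ : c ⟶ a) (r : a ⟶ c) (hr : ∀ x, x ≤ (r ≫ δ).toOrderHom x)
  {X : Intervals c ⥤ FintypeCat.{u}} {Y : Intervals a ⥤ FintypeCat.{u}}
  (π : X ⟶ Intervals.functor δ ⋙ Y) (ℓ : ⦋1⦌ ⟶ a) (k : Fin (c.len + 1))
  (h1 : ℓ.toOrderHom 1 = δ.toOrderHom k) (h2 : ∀ x, r.toOrderHom (ℓ.toOrderHom x) = k)
  {Z : Intervals ⦋1⦌ ⥤ FintypeCat.{u}} (φ : Z ⟶ Intervals.functor ℓ ⋙ Y)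
  (w : X.obj (.point k) ≅ Z.obj lastOne)

/-- The last vertex is the restriction of all intervals of the last edge. -/
def toResLast (I : Intervals ⦋1⦌) :
    Intervals.point k ⟶ (Intervals.functor r).obj ((Intervals.functor ℓ).obj I) :=
  homOfLE (Intervals.le_iff.2 ⟨(h2 _).ge, (h2 _).le⟩)

/-- The two descriptions of the last vertex agree. -/
def lastToPoint : (Intervals.functor ℓ).obj lastOne ⟶ (Intervals.functor δ).obj (.point k) :=
  homOfLE (Intervals.le_iff.2 ⟨h1.le, h1.ge⟩)

/-- The two descriptions of the last vertex agree. -/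
def pointToLast : (Intervals.functor δ).obj (.point k) ⟶ (Intervals.functor ℓ).obj lastOne :=
  homOfLE (Intervals.le_iff.2 ⟨h1.ge, h1.le⟩)

/-- Extension of intervals commutes with the inclusion of the last edge. -/
def extendLast (I : Intervals ⦋1⦌) : (Intervals.functor ℓ).obj (extendOne.obj I) ⟶
    (Intervals.extend (r ≫ δ) hr).obj ((Intervals.functor ℓ).obj I) :=
  homOfLE (Intervals.le_iff.2 ⟨le_rfl, by
    have e : δ.toOrderHom (r.toOrderHom (ℓ.toOrderHom I.hi)) = ℓ.toOrderHom 1 := by rw [h2, h1]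
    exact e.le.trans (ℓ.toOrderHom.monotone (one_le_apply _))⟩)

include h1 h2 in
lemma extendLast_eq (I : Intervals ⦋1⦌) : (Intervals.functor ℓ).obj (extendOne.obj I) =
    (Intervals.extend (r ≫ δ) hr).obj ((Intervals.functor ℓ).obj I) :=
  le_antisymm (leOfHom (extendLast δ r hr ℓ k h1 h2 I)) (Intervals.le_iff.2 ⟨le_rfl, by
    have e : δ.toOrderHom (r.toOrderHom (ℓ.toOrderHom I.hi)) = ℓ.toOrderHom 1 := by rw [h2, h1]
    exact (ℓ.toOrderHom.monotone (Fin.le_last _)).trans e.ge⟩)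

variable (hw : w.inv ≫ π.app (.point k) = φ.app lastOne ≫ Y.map (lastToPoint δ ℓ k h1))

/-- The components of the comparison of an edge with the last edge of `cartLift`. -/
noncomputable def edgeToCartLiftApp (I : Intervals ⦋1⦌) :
    Z.obj (extendOne.obj I) ⟶ (cartLift δ r hr π).obj ((Intervals.functor ℓ).obj I) :=
  (isPullback_cartLift δ r hr π ((Intervals.functor ℓ).obj I)).lift
    (Z.map (extendOneRes I) ≫ w.inv ≫ X.map (toResLast r ℓ k h2 I))
    (φ.app (extendOne.obj I) ≫ Y.map (extendLast δ r hr ℓ k h1 h2 I))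
    (by
      rw [Category.assoc, Category.assoc, Category.assoc, π.naturality, reassoc_of% hw,
        φ.naturality_assoc, Functor.comp_map, Functor.comp_map, ← Y.map_comp, ← Y.map_comp,
        ← Y.map_comp]
      rfl)

lemma edgeToCartLiftApp_fst (I : Intervals ⦋1⦌) :
    edgeToCartLiftApp δ r hr π ℓ k h1 h2 φ w hw I ≫ (cartFst δ r hr π).app _ =
      Z.map (extendOneRes I) ≫ w.inv ≫ X.map (toResLast r ℓ k h2 I) :=
  IsPullback.lift_fst _ _ _ _

lemma edgeToCartLiftApp_snd (I : Intervals ⦋1⦌) :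
    edgeToCartLiftApp δ r hr π ℓ k h1 h2 φ w hw I ≫ (cartSnd δ r hr π).app _ =
      φ.app (extendOne.obj I) ≫ Y.map (extendLast δ r hr ℓ k h1 h2 I) :=
  IsPullback.lift_snd _ _ _ _

/-- The comparison of an edge with the last edge of `cartLift`. -/
noncomputable def edgeToCartLift : extendOne ⋙ Z ⟶ Intervals.functor ℓ ⋙ cartLift δ r hr π where
  app I := edgeToCartLiftApp δ r hr π ℓ k h1 h2 φ w hw I
  naturality J J' f := (isPullback_cartLift δ r hr π ((Intervals.functor ℓ).obj J')).hom_ext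
    (by
      have := (cartFst δ r hr π).naturality ((Intervals.functor ℓ).map f)
      simp only [Functor.comp_map] at this ⊢
      rw [Category.assoc, Category.assoc, edgeToCartLiftApp_fst, this,
        reassoc_of% (edgeToCartLiftApp_fst δ r hr π ℓ k h1 h2 φ w hw J),
        ← X.map_comp, ← Z.map_comp_assoc]
      rfl)
    (by
      have := (cartSnd δ r hr π).naturality ((Intervals.functor ℓ).map f)
      simp only [Functor.comp_map] at this ⊢
      rw [Category.assoc, Category.assoc, edgeToCartLiftApp_snd, this,
        reassoc_of% (edgeToCartLiftApp_snd δ r hr π ℓ k h1 h2 φ w hw J), φ.naturality_assoc,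
        Functor.comp_map, ← Y.map_comp, ← Y.map_comp]
      rfl)

/-- The condition that the right square of an edge is a pullback. -/
def IsPullbackRight (φ : Z ⟶ Intervals.functor ℓ ⋙ Y) : Prop :=
  ∀ I, IsPullback (Z.map (extendOneRes I)) (φ.app (extendOne.obj I)) (φ.app lastOne)
    (Y.map ((Intervals.functor ℓ).map (extendOneRes I)))

/-- The condition that the left leg of an edge is an isomorphism. -/
def IsIsoLeft (Z : Intervals ⦋1⦌ ⥤ FintypeCat.{u}) : Prop :=
  ∀ I, IsIso (Z.map (extendOneTo.app I))

variable (hF : IsPullbackRight ℓ φ) (hZ : IsIsoLeft Z)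

-- The value of Z at the extended interval is a fibre product by the right square. Since r collapses
-- the last edge to one vertex, its cospan is isomorphic to the one defining `cartLift`.
include hF in
lemma isIso_edgeToCartLift : IsIso (edgeToCartLift δ r hr π ℓ k h1 h2 φ w hw) := by
  rw [NatTrans.isIso_iff_isIso_app]
  intro I
  have := isIso_map_of_eq X (toResLast r ℓ k h2 I) (Intervals.ext (h2 _).symm (h2 _).symm)
  have := isIso_map_of_eq Y (extendLast δ r hr ℓ k h1 h2 I) (extendLast_eq δ r hr ℓ k h1 h2 I)
  let f : (Intervals.functor ℓ).obj lastOne ⟶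
      (Intervals.functor δ).obj ((Intervals.functor r).obj ((Intervals.functor ℓ).obj I)) :=
    lastToPoint δ ℓ k h1 ≫ (Intervals.functor δ).map (toResLast r ℓ k h2 I)
  have e (x) : ℓ.toOrderHom 1 = δ.toOrderHom (r.toOrderHom (ℓ.toOrderHom x)) := by rw [h2, h1]
  have := isIso_map_of_eq Y f (Intervals.ext (e _) (e _))
  have h := (hF I).of_iso (Iso.refl _) (w.symm ≪≫ asIso (X.map (toResLast r ℓ k h2 I)))
    (asIso (Y.map (extendLast δ r hr ℓ k h1 h2 I))) (asIso (Y.map f))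
    (fst' := edgeToCartLiftApp δ r hr π ℓ k h1 h2 φ w hw I ≫ (cartFst δ r hr π).app _)
    (snd' := edgeToCartLiftApp δ r hr π ℓ k h1 h2 φ w hw I ≫ (cartSnd δ r hr π).app _)
    (f' := π.app ((Intervals.functor r).obj _))
    (g' := Y.map ((extendRes δ r hr).app _))
    (by rw [edgeToCartLiftApp_fst]; simp)
    (by rw [edgeToCartLiftApp_snd]; simp)
    (by
      simp only [Iso.trans_hom, Iso.symm_hom, asIso_hom, Category.assoc]
      rw [π.naturality, reassoc_of% hw, Functor.comp_map, ← Y.map_comp])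
    (by
      simp only [asIso_hom]
      rw [← Y.map_comp, ← Y.map_comp]
      rfl)
  have e : edgeToCartLiftApp δ r hr π ℓ k h1 h2 φ w hw I =
      (h.isoIsPullback _ _ (isPullback_cartLift δ r hr π _)).hom :=
    (isPullback_cartLift δ r hr π _).hom_ext (by simp) (by simp)
  change IsIso (edgeToCartLiftApp δ r hr π ℓ k h1 h2 φ w hw I)
  rw [e]
  infer_instance

/-- The isomorphism of the edge with its extension, if the left leg is an isomorphism. -/
noncomputable def extendOneIso : extendOne ⋙ Z ≅ Z :=
  have : IsIso (whiskerRight extendOneTo Z) := by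
    rw [NatTrans.isIso_iff_isIso_app]
    exact hZ
  asIso (whiskerRight extendOneTo Z : extendOne ⋙ Z ⟶ 𝟭 _ ⋙ Z) ≪≫ Z.leftUnitor

lemma extendOneIso_hom_app (I : Intervals ⦋1⦌) :
    (extendOneIso hZ).hom.app I = Z.map (extendOneTo.app I) := by
  simp [extendOneIso]

/-- The isomorphism of an edge with the last edge of `cartLift`. -/
noncomputable def edgeIsoCartLift : Z ≅ Intervals.functor ℓ ⋙ cartLift δ r hr π :=
  have := isIso_edgeToCartLift δ r hr π ℓ k h1 h2 φ w hw hF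
  (extendOneIso hZ).symm ≪≫ asIso (edgeToCartLift δ r hr π ℓ k h1 h2 φ w hw)

lemma extendOneIso_edgeIsoCartLift (I : Intervals ⦋1⦌) : Z.map (extendOneTo.app I) ≫
    (edgeIsoCartLift δ r hr π ℓ k h1 h2 φ w hw hF hZ).hom.app I =
      edgeToCartLiftApp δ r hr π ℓ k h1 h2 φ w hw I := by
  rw [← extendOneIso_hom_app hZ]
  simp [edgeIsoCartLift, ← NatTrans.comp_app_assoc]
  rfl

lemma edgeIsoCartLift_proj : (edgeIsoCartLift δ r hr π ℓ k h1 h2 φ w hw hF hZ).hom ≫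
    whiskerLeft (Intervals.functor ℓ) (cartProj δ r hr π) = φ := by
  ext I : 2
  have := hZ I
  rw [← cancel_epi (Z.map (extendOneTo.app I)), NatTrans.comp_app, ← Category.assoc,
    extendOneIso_edgeIsoCartLift, whiskerLeft_app, cartProj_app,
    reassoc_of% (edgeToCartLiftApp_snd δ r hr π ℓ k h1 h2 φ w hw I),
    ← Y.map_comp]
  exact (φ.naturality (extendOneTo.app I)).symm

/-- The isomorphism of `X` with the restriction of `cartLift`. -/
noncomputable def isoCartLift (hδ : δ ≫ r = 𝟙 c) : X ≅ Intervals.functor δ ⋙ cartLift δ r hr π :=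
  asIso (toCartLift δ r hr π hδ)

lemma isoCartLift_proj (hδ : δ ≫ r = 𝟙 c) : (isoCartLift δ r hr π hδ).hom ≫
    whiskerLeft (Intervals.functor δ) (cartProj δ r hr π) = π :=
  toCartLift_proj δ r hr π hδ

lemma functor_injective {a b : SimplexCategory} (θ : a ⟶ b)
    (hθ : Function.Injective θ.toOrderHom) {I J : Intervals a}
    (h : (Intervals.functor θ).obj I = (Intervals.functor θ).obj J) : I = J :=
  Intervals.ext (hθ (congrArg Intervals.lo h)) (hθ (congrArg Intervals.hi h))

/-- The last face and the last edge both prescribe a value at the last vertex; the two prescriptions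
can be glued only if their isomorphisms with `cartLift` agree there. This is tested on the two
projections. -/
lemma isoCartLift_edgeIsoCartLift (hδ : δ ≫ r = 𝟙 c) :
    (isoCartLift δ r hr π hδ).hom.app (.point k) ≫
      (cartLift δ r hr π).map (pointToLast δ ℓ k h1) =
        w.hom ≫ (edgeIsoCartLift δ r hr π ℓ k h1 h2 φ w hw hF hZ).hom.app lastOne := by
  let f : lastOne ⟶ extendOne.obj lastOne :=
    homOfLE (Intervals.le_iff.2 ⟨le_rfl, Fin.le_last _⟩)
  have e : (edgeIsoCartLift δ r hr π ℓ k h1 h2 φ w hw hF hZ).hom.app lastOne =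
      Z.map f ≫ edgeToCartLiftApp δ r hr π ℓ k h1 h2 φ w hw lastOne := by
    rw [← extendOneIso_edgeIsoCartLift, ← Z.map_comp_assoc, Subsingleton.elim (f ≫ _) (𝟙 _),
      Z.map_id]
    exact (Category.id_comp _).symm
  have e2 : w.hom ≫ φ.app lastOne = π.app (.point k) ≫ Y.map (pointToLast δ ℓ k h1) := by
    rw [← cancel_epi w.inv, reassoc_of% hw, w.inv_hom_id_assoc, ← Y.map_comp,
      Subsingleton.elim (lastToPoint δ ℓ k h1 ≫ _) (𝟙 _), Y.map_id]
    exact (Category.comp_id _).symm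
  rw [e]
  refine (isPullback_cartLift δ r hr π _).hom_ext ?_ ?_
  · rw [Category.assoc, Category.assoc, Category.assoc, edgeToCartLiftApp_fst,
      (cartFst δ r hr π).naturality, ← Z.map_comp_assoc, Subsingleton.elim (f ≫ _) (𝟙 _),
      Z.map_id, Category.id_comp, w.hom_inv_id_assoc]
    exact ((reassoc_of% (toCartLiftApp_fst δ r hr π hδ _)) _).trans (X.map_comp _ _).symm
  · rw [Category.assoc, Category.assoc, Category.assoc, edgeToCartLiftApp_snd,
      (cartSnd δ r hr π).naturality, φ.naturality_assoc, reassoc_of% e2]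
    refine ((reassoc_of% (toCartLiftApp_snd δ r hr π hδ _)) _).trans ?_
    rw [Functor.comp_map, Functor.comp_map, ← Y.map_comp, ← Y.map_comp, ← Y.map_comp]
    rfl

include h2 in
/-- The isomorphisms with values of `cartLift` coming from the last face, the last edge and a family
of further intervals are part of a family of isomorphisms. -/
lemma exists_cartSection (hδ : δ ≫ r = 𝟙 c) (hℓ : Function.Injective ℓ.toOrderHom)
    (h : X.obj (.point k) = Z.obj lastOne)
    (hw : (eqToIso h).inv ≫ π.app (.point k) = φ.app lastOne ≫ Y.map (lastToPoint δ ℓ k h1))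
    {ι : Type*} (pt : ι → Intervals a) (hpt : Function.Injective pt)
    (hV1 : ∀ i J, (Intervals.functor δ).obj J ≠ pt i)
    (hV2 : ∀ i J, (Intervals.functor ℓ).obj J ≠ pt i)
    (t : ∀ i, Σ A : FintypeCat.{u}, A ≅ (cartLift δ r hr π).obj (pt i)) :
    ∃ s : ∀ I, Σ A : FintypeCat.{u}, A ≅ (cartLift δ r hr π).obj I,
      (∀ J, s ((Intervals.functor δ).obj J) =
        ⟨X.obj J, (isoCartLift δ r hr π hδ).app J⟩) ∧
      (∀ J, s ((Intervals.functor ℓ).obj J) =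
        ⟨Z.obj J, (edgeIsoCartLift δ r hr π ℓ k h1 h2 φ (eqToIso h) hw hF hZ).app J⟩) ∧
      ∀ i, s (pt i) = t i := by
  have hδi : Function.Injective δ.toOrderHom := fun x y hxy => by
    rw [← retract_apply δ r hδ x, hxy, retract_apply δ r hδ y]
  -- An interval in both images is the last vertex: r sends every vertex of the last edge to k, and
  -- ℓ is injective.
  have key (J : Intervals c) (J' : Intervals ⦋1⦌)
      (hJ : (Intervals.functor δ).obj J = (Intervals.functor ℓ).obj J') :
      (⟨X.obj J, (isoCartLift δ r hr π hδ).app J⟩ :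
        Σ A : FintypeCat.{u}, A ≅ (cartLift δ r hr π).obj ((Intervals.functor δ).obj J)) ≍
      (⟨Z.obj J', (edgeIsoCartLift δ r hr π ℓ k h1 h2 φ (eqToIso h) hw hF hZ).app J'⟩ :
        Σ A : FintypeCat.{u}, A ≅ (cartLift δ r hr π).obj ((Intervals.functor ℓ).obj J')) := by
    have e1 : δ.toOrderHom J.lo = ℓ.toOrderHom J'.lo := congrArg Intervals.lo hJ
    have e2 : δ.toOrderHom J.hi = ℓ.toOrderHom J'.hi := congrArg Intervals.hi hJ
    have e3 : J.lo = k := by rw [← retract_apply δ r hδ J.lo, e1, h2]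
    have e4 : J.hi = k := by rw [← retract_apply δ r hδ J.hi, e2, h2]
    have e5 : J'.lo = 1 := hℓ (by rw [← e1, e3, h1])
    have e6 : J'.hi = 1 := hℓ (by rw [← e2, e4, h1])
    obtain rfl : J = .point k := Intervals.ext e3 e4
    obtain rfl : J' = lastOne := Intervals.ext e5 e6
    exact sigma_iso_heq _ (pointToLast δ ℓ k h1) hJ _ _ h
      (isoCartLift_edgeIsoCartLift δ r hr π ℓ k h1 h2 φ (eqToIso h) hw hF hZ hδ)
  have hne (I) : Nonempty (Σ A : FintypeCat.{u}, A ≅ (cartLift δ r hr π).obj I) :=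
    ⟨⟨_, Iso.refl _⟩⟩
  obtain ⟨s, hs⟩ := exists_section
    (T := fun I => Σ A : FintypeCat.{u}, A ≅ (cartLift δ r hr π).obj I)
    (ι := Intervals c ⊕ Intervals ⦋1⦌ ⊕ ι)
    (Sum.elim (Intervals.functor δ).obj (Sum.elim (Intervals.functor ℓ).obj pt))
    (fun i => match i with
      | .inl J => ⟨X.obj J, (isoCartLift δ r hr π hδ).app J⟩
      | .inr (.inl J) =>
        ⟨Z.obj J, (edgeIsoCartLift δ r hr π ℓ k h1 h2 φ (eqToIso h) hw hF hZ).app J⟩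
      | .inr (.inr I) => t I)
    (fun i j hij => by
      obtain J | J | I := i <;> obtain J' | J' | I' := j
      · obtain rfl := functor_injective δ hδi hij
        rfl
      · exact key J J' hij
      · exact (hV1 I' _ hij).elim
      · exact (key J' J hij.symm).symm
      · obtain rfl := functor_injective ℓ hℓ hij
        rfl
      · exact (hV2 I' _ hij).elim
      · exact (hV1 I _ hij.symm).elim
      · exact (hV2 I _ hij.symm).elim
      · obtain rfl := hpt hij
        rfl)
  exact ⟨s, fun J => hs (.inl J), fun J => hs (.inr (.inl J)), fun i => hs (.inr (.inr i))⟩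

end LastEdge

end SpanQuasi

/-! ### Uniqueness: equality of diagrams that agree on faces. -/

namespace SpanQuasi

open Functor

lemma le_of_functor_hom {a b : SimplexCategory} {θ : a ⟶ b}
    (hθ : Function.Injective θ.toOrderHom) {I J : Intervals a}
    (f : (Intervals.functor θ).obj I ⟶ (Intervals.functor θ).obj J) : I ≤ J := by
  have h : StrictMono θ.toOrderHom := θ.toOrderHom.monotone.strictMono_of_injective hθ
  have := Intervals.le_iff.1 (leOfHom f)
  exact Intervals.le_iff.2 ⟨h.le_iff_le.1 this.1, h.le_iff_le.1 this.2⟩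

section LeftNatural

variable {J : Type u'} [PartialOrder J] {C : Type u} [Category.{v} C] {H H' : J ⥤ Arrow C}
  (h : ∀ I, H.obj I = H'.obj I)

/-- Naturality on domains, at a given arrow, of the canonical maps between functors to the arrow
category that agree on objects. -/
def LeftNatural {I I' : J} (f : I ⟶ I') : Prop :=
  (H.map f).left ≫ (eqToHom (h I')).left = (eqToHom (h I)).left ≫ (H'.map f).left

variable {h}

lemma LeftNatural.comp {I I' I'' : J} {f : I ⟶ I'} {g : I' ⟶ I''} (hf : LeftNatural h f)
    (hg : LeftNatural h g) : LeftNatural h (f ≫ g) := by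
  unfold LeftNatural at *
  rw [H.map_comp, H'.map_comp, Arrow.comp_left, Arrow.comp_left, Category.assoc, hg,
    reassoc_of% hf]

lemma LeftNatural.of_eq {I I' : J} (f : I ⟶ I') (hI : I = I') : LeftNatural h f := by
  subst hI
  rw [Subsingleton.elim f (𝟙 _)]
  simp [LeftNatural]

lemma LeftNatural.of_epi {I I' I'' : J} {f : I ⟶ I'} {g : I' ⟶ I''} (hf : LeftNatural h f)
    (hfg : LeftNatural h (f ≫ g)) [Epi (H.map f).left] : LeftNatural h g := by
  unfold LeftNatural at *
  rw [H.map_comp, H'.map_comp, Arrow.comp_left, Arrow.comp_left, Category.assoc,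
    ← reassoc_of% hf, cancel_epi] at hfg
  exact hfg

lemma LeftNatural.of_comp_eq {J' : Type*} [PartialOrder J'] {ι : J' ⥤ J}
    (e : ι ⋙ H = ι ⋙ H') {I I' : J'} (f : I ⟶ I') : LeftNatural h (ι.map f) := by
  have := Arrow.hom.congr_left (Functor.congr_hom e f)
  rw [Arrow.comp_left, Arrow.comp_left, Functor.comp_map, Functor.comp_map] at this
  unfold LeftNatural
  rw [this]
  simp only [Arrow.eqToHom_left, Category.assoc, eqToHom_trans, eqToHom_refl, Category.comp_id]

lemma right_natural (e : H ⋙ Arrow.rightFunc = H' ⋙ Arrow.rightFunc) {I I' : J} (f : I ⟶ I') :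
    (H.map f).right ≫ (eqToHom (h I')).right = (eqToHom (h I)).right ≫ (H'.map f).right := by
  have : (H.map f).right = eqToHom (by rw [h]) ≫ (H'.map f).right ≫ eqToHom (by rw [h]) :=
    Functor.congr_hom e f
  rw [this, Arrow.eqToHom_right, Arrow.eqToHom_right, Category.assoc, Category.assoc,
    eqToHom_trans, eqToHom_refl, Category.comp_id]

lemma eq_of_leftNatural (e : H ⋙ Arrow.rightFunc = H' ⋙ Arrow.rightFunc)
    (hL : ∀ ⦃I I' : J⦄ (f : I ⟶ I'), LeftNatural h f) : H = H' :=
  CategoryTheory.Functor.ext h fun I I' f => by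
    rw [← Category.assoc, ← cancel_mono (eqToHom (h I'))]
    simp only [Category.assoc, eqToHom_trans, eqToHom_refl, Category.comp_id]
    exact Arrow.hom_ext _ _ (hL f) (right_natural e f)

/-- Naturality at an arrow can be checked after composing with an arrow that is, together with
the structure map of its source, jointly monic. -/
lemma LeftNatural.of_isPullback (e : H ⋙ Arrow.rightFunc = H' ⋙ Arrow.rightFunc) {I I' I'' : J}
    {f : I ⟶ I'} {g : I' ⟶ I''} (hg : LeftNatural h g) (hfg : LeftNatural h (f ≫ g))
    (hp : IsPullback (H'.map g).left (H'.obj I').hom (H'.obj I'').hom (H'.map g).right) :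
    LeftNatural h f := by
  refine hp.hom_ext ?_ ?_
  · unfold LeftNatural at hg hfg
    rw [H.map_comp, H'.map_comp, Arrow.comp_left, Arrow.comp_left, Category.assoc, hg] at hfg
    rw [Category.assoc, Category.assoc, hfg]
  · rw [Category.assoc, Category.assoc, Arrow.w, Arrow.w, Arrow.w_assoc, Arrow.w_assoc,
      right_natural e]

end LeftNatural

/-- The right square of an edge of `Span^×` is a pullback. -/
def RightSquare {C : Type u} [Category.{v} C] (E : Intervals ⦋1⦌ ⥤ Arrow C) : Prop :=
  ∀ I, IsPullback (E.map (extendOneRes I)).left (E.obj (extendOne.obj I)).hom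
    (E.obj lastOne).hom (E.map (extendOneRes I)).right

/-- The left leg of an edge of `Span^×` is an isomorphism on domains. -/
def LeftLegIso {C : Type u} [Category.{v} C] (E : Intervals ⦋1⦌ ⥤ Arrow C) : Prop :=
  ∀ I, IsIso (E.map (extendOneTo.app I)).left

section LastEdge

variable {a c : SimplexCategory} (δ : c ⟶ a) (r : a ⟶ c) (hr : ∀ x, x ≤ (r ≫ δ).toOrderHom x)
  (hδ : δ ≫ r = 𝟙 c) (ℓ : ⦋1⦌ ⟶ a) (k : Fin (c.len + 1))
  (h1 : ℓ.toOrderHom 1 = δ.toOrderHom k) (h2 : ∀ x, r.toOrderHom (ℓ.toOrderHom x) = k)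
  (hℓ : Function.Injective ℓ.toOrderHom)
  (hcov : ∀ x, (∃ y, δ.toOrderHom y = x) ∨ x = ℓ.toOrderHom 0)
  (htop : ∀ x, ℓ.toOrderHom 0 ≤ x → x = ℓ.toOrderHom 0 ∨ x = ℓ.toOrderHom 1)

include hδ in
lemma extend_functor_obj {I : Intervals a} {y} (hy : δ.toOrderHom y = I.hi) :
    (Intervals.extend (r ≫ δ) hr).obj I = I := by
  refine Intervals.ext rfl ?_
  change δ.toOrderHom (r.toOrderHom I.hi) = I.hi
  rw [← hy, retract_apply δ r hδ]

lemma exists_functor_obj {b : SimplexCategory} (θ : b ⟶ a) (hθ : Function.Injective θ.toOrderHom)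
    {I : Intervals a} {x y} (hx : θ.toOrderHom x = I.lo) (hy : θ.toOrderHom y = I.hi) :
    ∃ I', (Intervals.functor θ).obj I' = I := by
  have h : StrictMono θ.toOrderHom := θ.toOrderHom.monotone.strictMono_of_injective hθ
  exact ⟨Intervals.mk x y (h.le_iff_le.1 (by rw [hx, hy]; exact I.lo_le_hi)),
    Intervals.ext hx hy⟩

-- If I ends at the source of the last edge, then I⁺ is the union of I with that edge and they meet
-- in the source alone. The pullback property makes I⁺ ⟶ I a base change of the left leg. Otherwise
-- I⁺ = I.
include h1 h2 hδ hcov in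
lemma isIso_map_extendTo {C : Type u} [Category.{v} C] [HasPullbacks C]
    {H : Intervals a ⥤ Arrow C} (hH : PullbackProperty H)
    (hE : LeftLegIso (Intervals.functor ℓ ⋙ H)) (I : Intervals a) :
    IsIso (H.map ((Intervals.extendTo (r ≫ δ) hr).app I)).left := by
  obtain ⟨y, hy⟩ | h := hcov I.hi
  · have := isIso_map_of_eq H ((Intervals.extendTo (r ≫ δ) hr).app I)
      (extend_functor_obj δ r hr hδ hy)
    infer_instance
  · have he : ((Intervals.extend (r ≫ δ) hr).obj I).hi = ℓ.toOrderHom 1 := by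
      change δ.toOrderHom (r.toOrderHom I.hi) = _
      rw [h, h2, h1]
    let K : Intervals ⦋1⦌ := Intervals.point 0
    have h3 : (extendOne.obj K).hi = 1 := le_antisymm (Fin.le_last _) (one_le_apply _)
    have hlo : I.lo ≤ ℓ.toOrderHom 0 := I.lo_le_hi.trans h.le
    have hle : ℓ.toOrderHom 0 ≤ ℓ.toOrderHom 1 := ℓ.toOrderHom.monotone (Fin.zero_le _)
    obtain ⟨e1, e2⟩ := Intervals.union_of_ends
      (U := (Intervals.extend (r ≫ δ) hr).obj I) (I := I)
      (J := (Intervals.functor ℓ).obj (extendOne.obj K))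
      (K := (Intervals.functor ℓ).obj K)
      (min_eq_left hlo).symm
      (by
        rw [he, h, Intervals.hi_functor, h3, max_eq_right hle])
      (max_eq_right hlo).symm
      (by
        rw [h, Intervals.hi_functor, Intervals.hi_functor, h3, min_eq_left hle]; rfl)
    have := hE K
    have hle1 : (Intervals.extend (r ≫ δ) hr).obj I ≤
        (Intervals.functor ℓ).obj (extendOne.obj K) :=
      Intervals.le_iff.2 ⟨hlo, by rw [he, Intervals.hi_functor, h3]⟩
    have hle2 : I ≤ (Intervals.functor ℓ).obj K := Intervals.le_iff.2 ⟨hlo, h.ge⟩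
    have hsq := (hH ((Intervals.extendTo (r ≫ δ) hr).app I)
      (homOfLE hle1) (homOfLE hle2)
      ((Intervals.functor ℓ).map (extendOneTo.app K)) e1 e2).map Arrow.leftFunc
    have : IsIso (Arrow.leftFunc.map (H.map ((Intervals.functor ℓ).map (extendOneTo.app K)))) :=
      this
    exact hsq.isIso_fst_of_isIso

include h1 h2 hδ hℓ hcov htop in
/-- Functors on intervals with the pullback property that agree on bases, on the last face and on
the last edge, are equal if they agree on the intervals ending at the remaining vertex. -/
lemma eq_of_last_faces {C : Type u} [Category.{v} C] [HasPullbacks C]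
    {H H' : Intervals a ⥤ Arrow C} (hH : PullbackProperty H)
    (hE : LeftLegIso (Intervals.functor ℓ ⋙ H))
    (hE' : RightSquare (Intervals.functor ℓ ⋙ H))
    (e : H ⋙ Arrow.rightFunc = H' ⋙ Arrow.rightFunc)
    (eδ : Intervals.functor δ ⋙ H = Intervals.functor δ ⋙ H')
    (eℓ : Intervals.functor ℓ ⋙ H = Intervals.functor ℓ ⋙ H')
    (h : ∀ I, H.obj I = H'.obj I)
    (hpt : ∀ I : Intervals a, (∃ y, δ.toOrderHom y = I.lo) → I.hi = ℓ.toOrderHom 0 →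
      LeftNatural h ((Intervals.extendTo (r ≫ δ) hr).app I)) : H = H' := by
  have hδi : Function.Injective δ.toOrderHom := fun x y hxy => by
    rw [← retract_apply δ r hδ x, hxy, retract_apply δ r hδ y]
  have key {b : SimplexCategory} (θ : b ⟶ a) (hθ : Function.Injective θ.toOrderHom)
      (eθ : Intervals.functor θ ⋙ H = Intervals.functor θ ⋙ H') {I I' : Intervals a} (f : I ⟶ I')
      {x y x' y'} (hx : θ.toOrderHom x = I.lo) (hy : θ.toOrderHom y = I.hi)
      (hx' : θ.toOrderHom x' = I'.lo) (hy' : θ.toOrderHom y' = I'.hi) : LeftNatural h f := by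
    obtain ⟨I, rfl⟩ := exists_functor_obj θ hθ hx hy
    obtain ⟨I', rfl⟩ := exists_functor_obj θ hθ hx' hy'
    exact LeftNatural.of_comp_eq eθ (homOfLE (le_of_functor_hom hθ f))
  have hext (I : Intervals a) : LeftNatural h ((Intervals.extendTo (r ≫ δ) hr).app I) := by
    obtain ⟨y, hy⟩ | h3 := hcov I.hi
    · exact LeftNatural.of_eq _ (extend_functor_obj δ r hr hδ hy)
    obtain h4 | h4 := hcov I.lo
    · exact hpt I h4 h3
    · refine key ℓ hℓ eℓ (x := 0) (y := 1) (x' := 0) (y' := 0) _ h4.symm ?_ h4.symm h3.symm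
      change _ = δ.toOrderHom (r.toOrderHom I.hi)
      rw [h3, h2, h1]
  refine eq_of_leftNatural e (h := h) fun I I' f => ?_
  have := isIso_map_extendTo δ r hr hδ ℓ k h1 h2 hcov hH hE I
  -- As I⁺ ⟶ I is invertible on domains, naturality of the extension reduces the claim to maps I⁺ ⟶
  -- I'⁺, both of whose right ends lie in the last face.
  refine LeftNatural.of_epi (hext I) ?_
  rw [← Functor.id_map f, ← (Intervals.extendTo (r ≫ δ) hr).naturality f]
  refine LeftNatural.comp ?_ (hext I')
  have hIhi : ∃ y, δ.toOrderHom y = ((Intervals.extend (r ≫ δ) hr).obj I).hi := ⟨_, rfl⟩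
  have hIhi' : ∃ y, δ.toOrderHom y = ((Intervals.extend (r ≫ δ) hr).obj I').hi := ⟨_, rfl⟩
  revert hIhi hIhi'
  generalize (Intervals.extend (r ≫ δ) hr).map f = g
  generalize (Intervals.extend (r ≫ δ) hr).obj I = A at g ⊢
  generalize (Intervals.extend (r ≫ δ) hr).obj I' = B at g ⊢
  rintro ⟨y, hy⟩ ⟨y', hy'⟩
  have hne (z) : δ.toOrderHom z ≠ ℓ.toOrderHom 0 := by
    intro hz
    have : z = k := by rw [← retract_apply δ r hδ z, hz, h2]
    rw [this, ← h1] at hz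
    exact absurd (hℓ hz) (by decide)
  have hend (D : Intervals a) (z) (hz : δ.toOrderHom z = D.hi) (hD : ℓ.toOrderHom 0 ≤ D.hi) :
      D.hi = ℓ.toOrderHom 1 :=
    (htop _ hD).resolve_left (fun h => hne z (hz.trans h))
  obtain ⟨x', hx'⟩ | hB := hcov B.lo
  · obtain ⟨x, hx⟩ | hA := hcov A.lo
    · exact key δ hδi eδ g hx hy hx' hy'
    · have hA' := hend A y hy (hA ▸ A.lo_le_hi)
      have hB0 : ℓ.toOrderHom 0 ≤ B.lo := hA ▸ (Intervals.le_iff.1 (leOfHom g)).1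
      have hB' := hend B y' hy' (hB0.trans B.lo_le_hi)
      have hB1 := (htop _ hB0).resolve_left (fun h => hne x' (hx'.trans h))
      exact key ℓ hℓ eℓ g hA.symm hA'.symm hB1.symm hB'.symm
  · have hB' := hend B y' hy' (hB ▸ B.lo_le_hi)
    obtain ⟨x, hx⟩ | hA := hcov A.lo
    -- The only mixed case: the target is the full last edge and the source lies in the last face.
    -- The right square embeds the domain at the edge into the product of the domain at the last
    -- vertex, where the last face decides, and the base.
    · obtain rfl : B = (Intervals.functor ℓ).obj (extendOne.obj (.point 0)) :=
        Intervals.ext hB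
          (hB'.trans (congrArg ℓ.toOrderHom (le_antisymm (one_le_apply _) (Fin.le_last _))))
      refine LeftNatural.of_isPullback e
        (g := (Intervals.functor ℓ).map (extendOneRes (.point 0)))
        (LeftNatural.of_comp_eq eℓ _) ?_ ?_
      · exact key δ hδi eδ _ hx hy (x' := k) (y' := k) h1.symm h1.symm
      · rw [eℓ] at hE'
        exact hE' (.point 0)
    · have hA' := hend A y hy (hA ▸ A.lo_le_hi)
      exact key ℓ hℓ eℓ g hA.symm hA'.symm hB.symm hB'.symm

end LastEdge

end SpanQuasi

/-! ### Acyclic Kan fibrations and lifts of vertices. -/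

namespace SSetSlice

variable {S A B C : SSet.{u}} (p : S ⟶ A) (q : S ⟶ B) (f : A ⟶ C) (g : B ⟶ C) (w : p ≫ f = q ≫ g)

/-- The vertex `a` of `[n]`. -/
abbrev vertex {n : SimplexCategory} (a : Fin (n.len + 1)) : ⦋0⦌ ⟶ n := SimplexCategory.const ⦋0⦌ n a

lemma vertex_comp {n m : SimplexCategory} (a : Fin (n.len + 1)) (θ : n ⟶ m) :
    vertex a ≫ θ = vertex (θ.toOrderHom a) := rfl

/-- A map to a fibre product is an acyclic Kan fibration if it is surjective on vertices and
simplices of the source correspond to simplices of the target with a lift of the vertices. -/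
theorem isAcyclicKanFibration_of_vertices
    (h0 : ∀ (x : A _⦋0⦌) (y : B _⦋0⦌), f.app _ x = g.app _ y →
      ∃ z : S _⦋0⦌, p.app _ z = x ∧ q.app _ z = y)
    (h1 : ∀ (n : ℕ) (x : A _⦋n⦌) (y : B _⦋n⦌), f.app _ x = g.app _ y →
      ∀ z : Fin (n + 1) → S _⦋0⦌,
        (∀ a, p.app _ (z a) = A.map (vertex (n := ⦋n⦌) a).op x) →
        (∀ a, q.app _ (z a) = B.map (vertex (n := ⦋n⦌) a).op y) →
        ∃ s : S _⦋n⦌, p.app _ s = x ∧ q.app _ s = y ∧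
          ∀ a, S.map (vertex (n := ⦋n⦌) a).op s = z a)
    (h2 : ∀ (n : ℕ) (s s' : S _⦋n⦌), p.app _ s = p.app _ s' → q.app _ s = q.app _ s' →
      (∀ a, S.map (vertex (n := ⦋n⦌) a).op s = S.map (vertex (n := ⦋n⦌) a).op s') → s = s') :
    IsAcyclicKanFibration (pullback.lift p q w) := by
  intro n
  refine ⟨fun {t b} sq => ?_⟩
  have sp : t ≫ p = (SSet.boundary.{u} n).ι ≫ b ≫ pullback.fst f g := by
    rw [← sq.w_assoc, pullback.lift_fst]
  have sQ : t ≫ q = (SSet.boundary.{u} n).ι ≫ b ≫ pullback.snd f g := by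
    rw [← sq.w_assoc, pullback.lift_snd]
  obtain ⟨x, hx⟩ := SSet.yonedaEquiv.symm.surjective (b ≫ pullback.fst f g)
  obtain ⟨y, hy⟩ := SSet.yonedaEquiv.symm.surjective (b ≫ pullback.snd f g)
  rw [← hx] at sp
  rw [← hy] at sQ
  have hxy : f.app _ x = g.app _ y := by
    apply SSet.yonedaEquiv.symm.injective
    rw [← SSet.yonedaEquiv_symm_comp, ← SSet.yonedaEquiv_symm_comp, hx, hy, Category.assoc,
      Category.assoc, pullback.condition]
  let vtx (a : Fin (n + 1)) : (Δ[n] : SSet.{u}) _⦋0⦌ :=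
    SSet.stdSimplex.objEquiv.symm (vertex (n := ⦋n⦌) a)
  -- A vertex of the boundary is lifted by the given map t; the other case, which occurs only for n
  -- = 0, is the use of `h0`.
  have hz (a : Fin (n + 1)) : ∃ z : S _⦋0⦌, p.app _ z = A.map (vertex (n := ⦋n⦌) a).op x ∧
      q.app _ z = B.map (vertex (n := ⦋n⦌) a).op y ∧
      ∀ h : vtx a ∈ (SSet.boundary.{u} n).obj (op ⦋0⦌), z = t.app _ ⟨vtx a, h⟩ := by
    by_cases h : vtx a ∈ (SSet.boundary.{u} n).obj (op ⦋0⦌)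
    · refine ⟨t.app _ ⟨vtx a, h⟩, ?_, ?_, fun _ => rfl⟩
      · refine (ConcreteCategory.congr_hom (NatTrans.congr_app sp _) ⟨vtx a, h⟩).trans ?_
        exact SSet.yonedaEquiv_symm_app_objEquiv_symm _ _
      · refine (ConcreteCategory.congr_hom (NatTrans.congr_app sQ _) ⟨vtx a, h⟩).trans ?_
        exact SSet.yonedaEquiv_symm_app_objEquiv_symm _ _
    · obtain ⟨z, hz1, hz2⟩ := h0 (A.map (vertex (n := ⦋n⦌) a).op x)
        (B.map (vertex (n := ⦋n⦌) a).op y)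
        (by rw [NatTrans.naturality_apply, NatTrans.naturality_apply, hxy])
      exact ⟨z, hz1, hz2, fun h' => (h h').elim⟩
  choose z hz1 hz2 hz3 using hz
  obtain ⟨s, hs1, hs2, hs3⟩ := h1 n x y hxy z hz1 hz2
  refine ⟨⟨⟨SSet.yonedaEquiv.symm s, ?_, ?_⟩⟩⟩
  · ext ⟨⟨m⟩⟩ ⟨φ, hφ⟩
    obtain ⟨φ, rfl⟩ := SSet.stdSimplex.objEquiv.symm.surjective φ
    have e : SSet.Subcomplex.ι _ ≫ SSet.yonedaEquiv.symm s ≫ p = t ≫ p := by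
      rw [sp, SSet.yonedaEquiv_symm_comp, hs1]
    have e' : SSet.Subcomplex.ι _ ≫ SSet.yonedaEquiv.symm s ≫ q = t ≫ q := by
      rw [sQ, SSet.yonedaEquiv_symm_comp, hs2]
    -- The new simplex and t have the same image and the same vertices on each boundary simplex, so
    -- uniqueness makes them equal there.
    refine h2 _ _ _ (ConcreteCategory.congr_hom (NatTrans.congr_app e _) ⟨_, hφ⟩)
      (ConcreteCategory.congr_hom (NatTrans.congr_app e' _) ⟨_, hφ⟩) fun a => ?_
    have hl : S.map (vertex (n := ⦋m⦌) a).op (S.map φ.op s) =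
        S.map (vertex (n := ⦋n⦌) (φ.toOrderHom a)).op s := by
      rw [← Functor.map_comp_apply, ← op_comp, vertex_comp]
    have hmem := (SSet.boundary.{u} n).map (vertex (n := ⦋m⦌) a).op hφ
    exact (hl.trans (hs3 _)).trans ((hz3 (φ.toOrderHom a) hmem).trans
      (NatTrans.naturality_apply t (vertex (n := ⦋m⦌) a).op
        ⟨SSet.stdSimplex.objEquiv.symm φ, hφ⟩))
  · refine pullback.hom_ext ?_ ?_
    · rw [Category.assoc, pullback.lift_fst, ← hx, SSet.yonedaEquiv_symm_comp, hs1]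
    · rw [Category.assoc, pullback.lift_snd, ← hy, SSet.yonedaEquiv_symm_comp, hs2]

variable {p q f g w}

/-- The boundary of a point is empty, so every vertex of the fibre product poses a lifting problem.
-/
lemma IsAcyclicKanFibration.exists_vertex (H : IsAcyclicKanFibration (pullback.lift p q w))
    (x : A _⦋0⦌) (y : B _⦋0⦌) (hxy : f.app _ x = g.app _ y) :
    ∃ z : S _⦋0⦌, p.app _ z = x ∧ q.app _ z = y := by
  have := H 0
  have hfalse {X} (φ : ((SSet.boundary.{u} 0 : SSet.{u})).obj X) : False :=
    φ.2 fun _ => ⟨0, Subsingleton.elim (α := Fin 1) _ _⟩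
  let t : (SSet.boundary.{u} 0 : SSet.{u}) ⟶ S :=
    { app X := ↾fun φ => (hfalse φ).elim
      naturality X Y θ := by ext φ; exact (hfalse φ).elim }
  have sq : CommSq t (SSet.boundary.{u} 0).ι (pullback.lift p q w)
      (pullback.lift (SSet.yonedaEquiv.symm x) (SSet.yonedaEquiv.symm y) (by
        rw [SSet.yonedaEquiv_symm_comp, SSet.yonedaEquiv_symm_comp, hxy])) :=
    ⟨by apply NatTrans.ext; ext X j φ; exact (hfalse φ).elim⟩
  have e := sq.fac_right
  refine ⟨SSet.yonedaEquiv sq.lift, ?_, ?_⟩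
  · apply SSet.yonedaEquiv.symm.injective
    rw [← SSet.yonedaEquiv_symm_comp, Equiv.symm_apply_apply]
    have h1 := congrArg (· ≫ pullback.fst f g) e
    simp only [Category.assoc, pullback.lift_fst] at h1
    exact h1
  · apply SSet.yonedaEquiv.symm.injective
    rw [← SSet.yonedaEquiv_symm_comp, Equiv.symm_apply_apply]
    have h1 := congrArg (· ≫ pullback.snd f g) e
    simp only [Category.assoc, pullback.lift_snd] at h1
    exact h1

/-- The map from the boundary of an edge given by two vertices. -/
def boundaryOneDesc (z : Fin 2 → S _⦋0⦌) : (SSet.boundary.{u} 1 : SSet.{u}) ⟶ S where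
  app X := ↾fun φ => S.map (SimplexCategory.const X.unop ⦋0⦌ 0).op
    (z ((SSet.stdSimplex.objEquiv φ.1).toOrderHom 0))
  naturality X Y θ := by
    ext φ
    -- A map to `[1]` that is not surjective is constant.
    have hφ : (SSet.stdSimplex.objEquiv φ.1).toOrderHom (θ.unop.toOrderHom 0) =
        (SSet.stdSimplex.objEquiv φ.1).toOrderHom 0 := by
      by_contra h
      refine φ.2 fun (i : Fin 2) => ?_
      by_cases hi : i = (SSet.stdSimplex.objEquiv φ.1).toOrderHom 0
      · exact ⟨0, hi.symm⟩
      · refine ⟨θ.unop.toOrderHom 0, ?_⟩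
        change (SSet.stdSimplex.objEquiv φ.1).toOrderHom (θ.unop.toOrderHom 0) = i
        revert h hi
        generalize (SSet.stdSimplex.objEquiv φ.1).toOrderHom (θ.unop.toOrderHom 0) = x
        generalize (SSet.stdSimplex.objEquiv φ.1).toOrderHom 0 = y
        revert x y i
        change ∀ i x y : Fin 2, _
        decide
    change S.map _ (z ((SSet.stdSimplex.objEquiv φ.1).toOrderHom (θ.unop.toOrderHom 0))) =
      S.map _ (S.map _ _)
    rw [hφ, ← Functor.map_comp_apply]
    rfl

/-- Every simplex of the boundary of an edge is constant, so the lifting square commutes as soon as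
it does on the two vertices. -/
lemma IsAcyclicKanFibration.exists_edge (H : IsAcyclicKanFibration (pullback.lift p q w))
    (x : A _⦋1⦌) (y : B _⦋1⦌) (hxy : f.app _ x = g.app _ y) (z : Fin 2 → S _⦋0⦌)
    (hz : ∀ a, p.app _ (z a) = A.map (vertex (n := ⦋1⦌) a).op x)
    (hz' : ∀ a, q.app _ (z a) = B.map (vertex (n := ⦋1⦌) a).op y) :
    ∃ s : S _⦋1⦌, p.app _ s = x ∧ q.app _ s = y ∧
      ∀ a, S.map (vertex (n := ⦋1⦌) a).op s = z a := by
  have := H 1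
  have hmem (a : Fin 2) : SSet.stdSimplex.objEquiv.symm (vertex (n := ⦋1⦌) a) ∈
      (SSet.boundary.{u} 1).obj (op ⦋0⦌) := by
    intro h
    obtain ⟨i, hi⟩ := h 0
    obtain ⟨j, hj⟩ := h 1
    exact absurd (hi.symm.trans hj) (by decide)
  have hconst {X : SimplexCategoryᵒᵖ} (φ : X.unop ⟶ ⦋1⦌)
      (hφ : ¬ Function.Surjective φ.toOrderHom) :
      φ = SimplexCategory.const X.unop ⦋0⦌ 0 ≫ vertex (n := ⦋1⦌) (φ.toOrderHom 0) := by
    refine SimplexCategory.Hom.ext _ _ (OrderHom.ext _ _ (funext fun j => ?_))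
    change φ.toOrderHom j = φ.toOrderHom 0
    by_contra h
    refine hφ fun (i : Fin 2) => ?_
    by_cases hi : i = φ.toOrderHom 0
    · exact ⟨0, hi.symm⟩
    · refine ⟨j, ?_⟩
      revert h hi
      generalize φ.toOrderHom j = x
      generalize φ.toOrderHom 0 = y
      revert x y i
      change ∀ i x y : Fin 2, _
      decide
  have sq : CommSq (boundaryOneDesc z) (SSet.boundary.{u} 1).ι (pullback.lift p q w)
      (pullback.lift (SSet.yonedaEquiv.symm x) (SSet.yonedaEquiv.symm y) (by
        rw [SSet.yonedaEquiv_symm_comp, SSet.yonedaEquiv_symm_comp, hxy])) := by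
    refine ⟨pullback.hom_ext ?_ ?_⟩
    · rw [Category.assoc, Category.assoc, pullback.lift_fst, pullback.lift_fst]
      ext X φ
      change p.app _ (S.map _ (z _)) = A.map (SSet.stdSimplex.objEquiv φ.1).op x
      rw [NatTrans.naturality_apply, hz, ← Functor.map_comp_apply, ← op_comp]
      exact congrArg (fun θ => A.map (Quiver.Hom.op θ) x) (hconst _ φ.2).symm
    · rw [Category.assoc, Category.assoc, pullback.lift_snd, pullback.lift_snd]
      ext X φ
      change q.app _ (S.map _ (z _)) = B.map (SSet.stdSimplex.objEquiv φ.1).op y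
      rw [NatTrans.naturality_apply, hz', ← Functor.map_comp_apply, ← op_comp]
      exact congrArg (fun θ => B.map (Quiver.Hom.op θ) y) (hconst _ φ.2).symm
  have e := sq.fac_right
  have e' := sq.fac_left
  refine ⟨SSet.yonedaEquiv sq.lift, ?_, ?_, fun a => ?_⟩
  · apply SSet.yonedaEquiv.symm.injective
    rw [← SSet.yonedaEquiv_symm_comp, Equiv.symm_apply_apply]
    have h1 := congrArg (· ≫ pullback.fst f g) e
    simp only [Category.assoc, pullback.lift_fst] at h1
    exact h1
  · apply SSet.yonedaEquiv.symm.injective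
    rw [← SSet.yonedaEquiv_symm_comp, Equiv.symm_apply_apply]
    have h1 := congrArg (· ≫ pullback.snd f g) e
    simp only [Category.assoc, pullback.lift_snd] at h1
    exact h1
  · have h1 := ConcreteCategory.congr_hom (NatTrans.congr_app e' (op ⦋0⦌)) ⟨_, hmem a⟩
    have h2 := SSet.yonedaEquiv_symm_app_objEquiv_symm (SSet.yonedaEquiv sq.lift)
      (vertex (n := ⦋1⦌) a)
    rw [Equiv.symm_apply_apply] at h2
    refine h2.symm.trans (h1.trans ?_)
    change S.map (SimplexCategory.const ⦋0⦌ ⦋0⦌ 0).op (z a) = z a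
    rw [SimplexCategory.const_eq_id]
    simp

end SSetSlice

/-! ### Vertices of the joins with a point and with an edge. -/

namespace SSetSlice

/-- The inclusion `[n] ⋆ [0] ⟶ [n] ⋆ [1]` onto the face that contains the last vertex. -/
abbrev lastFace (n : ℕ) : join ⦋n⦌ ⦋0⦌ ⟶ join ⦋n⦌ ⦋1⦌ := joinMap (𝟙 ⦋n⦌) (SimplexCategory.δ 0)

/-- The retraction of `lastFace`. -/
abbrev lastFaceRetract (n : ℕ) : join ⦋n⦌ ⦋1⦌ ⟶ join ⦋n⦌ ⦋0⦌ :=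
  joinMap (𝟙 ⦋n⦌) (SimplexCategory.σ 0)

/-- The last vertex of `[n] ⋆ [0]`. -/
abbrev lastVertex (n : ℕ) : Fin ((join ⦋n⦌ ⦋0⦌).len + 1) := (joinInr ⦋n⦌ ⦋0⦌).toOrderHom 0

lemma lastFace_comp_retract (n : ℕ) : lastFace n ≫ lastFaceRetract n = 𝟙 _ := by
  rw [← joinMap_comp, Category.comp_id]
  exact (congrArg _ (SimplexCategory.δ_comp_σ_self (i := 0))).trans (joinMap_id _ _)

lemma joinMap_joinInr_apply {a a' b b' : SimplexCategory} (θ : a ⟶ a') (φ : b ⟶ b')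
    (x : Fin (b.len + 1)) : (joinMap θ φ).toOrderHom ((joinInr a b).toOrderHom x) =
      (joinInr a' b').toOrderHom (φ.toOrderHom x) :=
  congrArg (fun f => f.toOrderHom x) (joinInr_joinMap θ φ)

lemma le_lastFace_retract (n : ℕ) (x : Fin ((join ⦋n⦌ ⦋1⦌).len + 1)) :
    x ≤ (lastFaceRetract n ≫ lastFace n).toOrderHom x := by
  rw [← joinMap_comp, Category.comp_id, Fin.le_def]
  obtain h | ⟨j, h⟩ := join_cases x
  · rw [joinMap_left _ _ x h]
    rfl
  · rw [joinMap_right _ _ x j h, h]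
    exact Nat.add_le_add_left
      (Fin.le_def.1 ((Fin.le_last j).trans (SpanQuasi.one_le_apply j))) _

lemma joinInr_one (n : ℕ) :
    (joinInr ⦋n⦌ ⦋1⦌).toOrderHom 1 = (lastFace n).toOrderHom (lastVertex n) :=
  (joinMap_joinInr_apply (𝟙 ⦋n⦌) (SimplexCategory.δ (n := 0) 0) 0).symm

lemma lastFaceRetract_joinInr (n : ℕ) (x) :
    (lastFaceRetract n).toOrderHom ((joinInr ⦋n⦌ ⦋1⦌).toOrderHom x) = lastVertex n :=
  (joinMap_joinInr_apply _ _ _).trans (congrArg _ (Subsingleton.elim (α := Fin 1) _ _))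

lemma joinInr_injective (a b : SimplexCategory) : Function.Injective (joinInr a b).toOrderHom := by
  intro x y h
  have h' : a.len + 1 + x.1 = a.len + 1 + y.1 := congrArg Fin.val h
  exact Fin.ext (by omega)

lemma eq_zero_or_one (j : Fin ((⦋1⦌ : SimplexCategory).len + 1)) : j = 0 ∨ j = 1 := by
  revert j
  change ∀ j : Fin 2, _
  decide

lemma lastFace_cover (n : ℕ) (x : Fin ((join ⦋n⦌ ⦋1⦌).len + 1)) :
    (∃ y, (lastFace n).toOrderHom y = x) ∨ x = (joinInr ⦋n⦌ ⦋1⦌).toOrderHom 0 := by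
  obtain h | ⟨j, h⟩ := join_cases x
  · have hx : x.1 < (join ⦋n⦌ ⦋0⦌).len + 1 := by
      have : x.1 < n + 1 := h
      change x.1 < n + 1 + 0 + 1
      omega
    exact Or.inl ⟨⟨x.1, hx⟩, Fin.ext
      (joinMap_left (b := ⦋0⦌) (b' := ⦋1⦌) (𝟙 ⦋n⦌) (SimplexCategory.δ 0) ⟨x.1, hx⟩ h)⟩
  · obtain rfl | rfl := eq_zero_or_one j
    · exact Or.inr (Fin.ext h)
    · exact Or.inl ⟨_, (joinInr_one n).symm.trans (Fin.ext h.symm)⟩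

lemma eq_of_joinInr_zero_le (n : ℕ) (x : Fin ((join ⦋n⦌ ⦋1⦌).len + 1))
    (hx : (joinInr ⦋n⦌ ⦋1⦌).toOrderHom 0 ≤ x) :
    x = (joinInr ⦋n⦌ ⦋1⦌).toOrderHom 0 ∨ x = (joinInr ⦋n⦌ ⦋1⦌).toOrderHom 1 := by
  obtain h | ⟨j, h⟩ := join_cases x
  · have h1 : n + 1 ≤ x.1 := hx
    have h2 : x.1 < n + 1 := h
    omega
  · obtain rfl | rfl := eq_zero_or_one j
    · exact Or.inl (Fin.ext h)
    · exact Or.inr (Fin.ext h)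

end SSetSlice

/-! ### Conditions on an edge, and the intervals where a filler is not determined. -/

namespace SpanQuasi

open Functor SSetSlice

lemma arrow_mk_eq {J : Type*} [PartialOrder J] {C : Type u} [Category.{v} C] (Y : J ⥤ C)
    {I I' : J} {A B : C} {f : A ⟶ Y.obj I} {g : B ⟶ Y.obj I'} (m : I ⟶ I') (hI : I = I')
    (h : Arrow.mk f = Arrow.mk g) : ∃ e : A = B, f ≫ Y.map m = eqToHom e ≫ g := by
  subst hI
  refine ⟨congrArg Comma.left h, ?_⟩
  have := Arrow.w (eqToHom h)
  rw [Arrow.eqToHom_left, Arrow.eqToHom_right] at this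
  rw [Subsingleton.elim m (𝟙 _), Y.map_id]
  exact this.symm

lemma arrow_mk_congr {C : Type u} [Category.{v} C] {A B D : C} {f : A ⟶ D} {g : B ⟶ D} (e : A = B)
    (h : f = eqToHom e ≫ g) : Arrow.mk f = Arrow.mk g := by
  subst e
  rw [h, eqToHom_refl, Category.id_comp]

lemma sigma_iso_hom {C : Type u} [Category.{v} C] {P : C} {σ τ : Σ Z : C, Z ≅ P} (h : σ = τ) :
    σ.2.hom = eqToHom (congrArg Sigma.fst h) ≫ τ.2.hom := by
  subst h
  simp

section Edge

variable (F : SpanTimes.{u} _⦋1⦌)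

/-- Only the interval {0} carries content; those that end at 1 equal their extension. -/
lemma leftLegIso_iff : LeftLegIso F.1 ↔ IsIso (edgeLeft F).left := by
  refine ⟨fun h => h (.point 0), fun h I => ?_⟩
  obtain hI | hI := eq_zero_or_one I.hi
  · obtain rfl : I = .point 0 :=
      Intervals.ext (le_antisymm (I.lo_le_hi.trans hI.le) (Fin.zero_le _)) hI
    exact h
  · have := isIso_map_of_eq F.1 (extendOneTo.app I)
      (Intervals.ext rfl ((le_antisymm (Fin.le_last _) (one_le_apply _)).trans hI.symm))
    infer_instance

/-- The intervals {0} and {0, 1} have the same extension and give the actual square; for {1} the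
horizontal maps are isomorphisms. -/
lemma rightSquare_iff : RightSquare F.1 ↔
    IsPullback (edgeRight F).left (edgeApex F).hom (edgeTarget F).hom (edgeRight F).right := by
  refine ⟨fun h => h (.point 0), fun h I => ?_⟩
  obtain hI | hI := eq_zero_or_one I.lo
  · obtain hI' | hI' := eq_zero_or_one I.hi
    · obtain rfl : I = .point 0 := Intervals.ext hI hI'
      exact h
    · obtain rfl : I = extendOne.obj (.point 0) := Intervals.ext hI hI'
      exact h
  · have := isIso_map_of_eq F.1 (extendOneRes I)
      (Intervals.ext hI (le_antisymm (Fin.le_last _) (one_le_apply _)))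
    exact IsPullback.of_horiz_isIso ⟨Arrow.w _⟩

end Edge

section Filler

variable {n : ℕ}

/-- The inclusion `[0] ⋆ [1] ⟶ [n] ⋆ [1]` given by a vertex of `[n]`. -/
abbrev vertexJoin (n : ℕ) (x : Fin (n + 1)) : join ⦋0⦌ ⦋1⦌ ⟶ join ⦋n⦌ ⦋1⦌ :=
  joinMap (vertex (n := ⦋n⦌) x) (𝟙 ⦋1⦌)

/-- The inclusion `[0] ⋆ [0] ⟶ [n] ⋆ [0]` given by a vertex of `[n]`. -/
abbrev vertexJoinZero (n : ℕ) (x : Fin (n + 1)) : join ⦋0⦌ ⦋0⦌ ⟶ join ⦋n⦌ ⦋0⦌ :=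
  joinMap (vertex (n := ⦋n⦌) x) (𝟙 ⦋0⦌)

lemma lastFace_vertexJoin (x : Fin (n + 1)) :
    lastFace 0 ≫ vertexJoin n x = vertexJoinZero n x ≫ lastFace n := by
  rw [← joinMap_comp, ← joinMap_comp]
  rfl

/-- The interval `{0, 1}` of `[0] ⋆ [1]`. -/
abbrev midEdge : Intervals (join ⦋0⦌ ⦋1⦌) :=
  Intervals.mk (a := join ⦋0⦌ ⦋1⦌) 0 ((joinInr ⦋0⦌ ⦋1⦌).toOrderHom 0) (Fin.zero_le _)

/-- The interval `{0, 1}` of `[0] ⋆ [0]`. -/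
abbrev fullEdge : Intervals (join ⦋0⦌ ⦋0⦌) :=
  Intervals.mk (a := join ⦋0⦌ ⦋0⦌) 0 ((joinInr ⦋0⦌ ⦋0⦌).toOrderHom 0) (Fin.zero_le _)

/-- The inclusion of the first edge into the full interval. -/
def fullToMid : (Intervals.functor (lastFace 0)).obj fullEdge ⟶ midEdge :=
  homOfLE (Intervals.le_iff.2 ⟨Fin.zero_le _, by
    refine le_trans ?_ (joinInr_one 0).le
    exact (joinInr ⦋0⦌ ⦋1⦌).toOrderHom.monotone (Fin.zero_le _)⟩)

lemma functor_vertexJoin_obj (x : Fin (n + 1)) (J : Intervals (join ⦋0⦌ ⦋0⦌)) :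
    (Intervals.functor (lastFace n)).obj ((Intervals.functor (vertexJoinZero n x)).obj J) =
      (Intervals.functor (vertexJoin n x)).obj ((Intervals.functor (lastFace 0)).obj J) :=
  (congrArg (fun θ => (Intervals.functor θ).obj J) (lastFace_vertexJoin x)).symm

/-- The image of `fullToMid` in `[n] ⋆ [1]`. -/
def fullToMidVertex (x : Fin (n + 1)) :
    (Intervals.functor (lastFace n)).obj ((Intervals.functor (vertexJoinZero n x)).obj fullEdge) ⟶
      (Intervals.functor (vertexJoin n x)).obj midEdge :=
  homOfLE ((functor_vertexJoin_obj x fullEdge).le.trans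
    (leOfHom ((Intervals.functor (vertexJoin n x)).map fullToMid)))

lemma lo_midEdge_image (x : Fin (n + 1)) :
    ((Intervals.functor (vertexJoin n x)).obj midEdge).lo.1 = x.1 :=
  joinMap_left (vertex (n := ⦋n⦌) x) (𝟙 ⦋1⦌) _ (Nat.zero_lt_one)

lemma hi_midEdge_image (x : Fin (n + 1)) :
    ((Intervals.functor (vertexJoin n x)).obj midEdge).hi = (joinInr ⦋n⦌ ⦋1⦌).toOrderHom 0 :=
  joinMap_joinInr_apply _ _ _

lemma midEdge_image_injective :
    Function.Injective fun x => (Intervals.functor (vertexJoin n x)).obj midEdge := by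
  intro x y h
  have := congrArg (fun I => I.lo.1) h
  simp only [lo_midEdge_image] at this
  exact Fin.ext this

lemma lastFace_ne_zero (y) :
    (lastFace n).toOrderHom y ≠ (joinInr ⦋n⦌ ⦋1⦌).toOrderHom 0 := by
  intro hz
  have : y = lastVertex n := by
    rw [← retract_apply _ _ (lastFace_comp_retract n) y, hz, lastFaceRetract_joinInr]
  rw [this, ← joinInr_one] at hz
  exact absurd (joinInr_injective _ _ hz) (by decide)

lemma functor_lastFace_ne (x : Fin (n + 1)) (J) : (Intervals.functor (lastFace n)).obj J ≠
    (Intervals.functor (vertexJoin n x)).obj midEdge := fun h =>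
  lastFace_ne_zero _ ((congrArg Intervals.hi h).trans (hi_midEdge_image x))

lemma functor_joinInr_ne (x : Fin (n + 1)) (J) : (Intervals.functor (joinInr ⦋n⦌ ⦋1⦌)).obj J ≠
    (Intervals.functor (vertexJoin n x)).obj midEdge := fun h => by
  have h1 : n + 1 + J.lo.1 = x.1 := (congrArg (fun I => I.lo.1) h).trans (lo_midEdge_image x)
  have := x.2
  omega

end Filler

end SpanQuasi

/-! ### Existence and uniqueness of fillers. -/

namespace SpanQuasi

open Functor SSetSlice

section Filler

variable {n : ℕ} {F : Intervals ⦋1⦌ ⥤ Arrow FintypeCat.{u}}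

lemma lastFace_injective (n : ℕ) : Function.Injective (lastFace n).toOrderHom := fun x y hxy => by
  rw [← retract_apply _ _ (lastFace_comp_retract n) x, hxy,
    retract_apply _ _ (lastFace_comp_retract n) y]

lemma extend_midEdge :
    (Intervals.extend (lastFaceRetract 0 ≫ lastFace 0) (le_lastFace_retract 0)).obj midEdge =
      (Intervals.functor (lastFace 0)).obj fullEdge := by
  refine Intervals.ext (Fin.ext (joinMap_left (b := ⦋0⦌) (b' := ⦋1⦌) (𝟙 ⦋0⦌)
    (SimplexCategory.δ (n := 0) 0) (0 : Fin 2) Nat.zero_lt_one).symm) ?_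
  exact congrArg (lastFace 0).toOrderHom (lastFaceRetract_joinInr 0 0)

lemma functor_comp_congr {a b b' d : SimplexCategory} {C : Type u} [Category.{v} C] {θ : a ⟶ b}
    {θ' : b ⟶ d} {φ : a ⟶ b'} {φ' : b' ⟶ d} (h : θ ≫ θ' = φ ≫ φ') (H : Intervals d ⥤ C) :
    Intervals.functor θ ⋙ Intervals.functor θ' ⋙ H =
      Intervals.functor φ ⋙ Intervals.functor φ' ⋙ H :=
  congrArg (fun θ => Intervals.functor θ ⋙ H) h

lemma map_eq_eqToHom {J : Type*} [PartialOrder J] {C : Type u} [Category.{v} C] (F : J ⥤ C)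
    {I I' : J} (f : I ⟶ I') (h : I = I') : F.map f = eqToHom (congrArg F.obj h) := by
  subst h
  rw [Subsingleton.elim f (𝟙 _), F.map_id, eqToHom_refl]

lemma sigma_iso_comp {C : Type u} [Category.{v} C] {P P' A B D : C} {σ : Σ Z : C, Z ≅ P}
    {k : B ⟶ A} [IsIso k] {e : B = D} {α : D ≅ P'} {m : P' ⟶ P} [IsIso m]
    (h : σ = ⟨A, (asIso k).symm ≪≫ eqToIso e ≪≫ α ≪≫ asIso m⟩) :
    k ≫ eqToHom (congrArg Sigma.fst h).symm ≫ σ.2.hom = eqToHom e ≫ α.hom ≫ m := by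
  subst h
  simp

/-- The structure map at a prescribed middle value is determined after precomposition with the
isomorphism k, where it is that of the last face. Objects are variables so that equalities between
values can enter as hypotheses. -/
lemma eq_eqToHom_comp_of_mid {C : Type u} [Category.{v} C] {A A' B D P P' Q Q' Q'' : C}
    {k : B ⟶ A} [IsIso k] {e : A = A'} {t : A' ⟶ P} {e' : B = D} {α : D ⟶ P'} {m : P' ⟶ P}
    (hmid : k ≫ eqToHom e ≫ t = eqToHom e' ≫ α ≫ m) {c : P ⟶ Q} {c' : P' ⟶ Q'} {y : Q' ⟶ Q}
    (hc : m ≫ c = c' ≫ y) {p : D ⟶ Q'} (hp : α ≫ c' = p) {b : B ⟶ Q''} {y₀ : Q'' ⟶ Q'}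
    (hb : b ≫ y₀ = eqToHom e' ≫ p) {y₁ : Q'' ⟶ Q} (hy : y₁ = y₀ ≫ y) {a : A ⟶ Q}
    (ha : k ≫ a = b ≫ y₁) : a = eqToHom e ≫ t ≫ c := by
  rw [← cancel_epi k, ha, hy, reassoc_of% hb, reassoc_of% hmid, hc, ← hp, Category.assoc]

lemma comp_eqToHom_of_mid {C : Type u} [Category.{v} C] {A A' B D D' B' P P' : C}
    {k : B ⟶ A} {e : A = A'} {t : A' ≅ P} {e' : B = D} {α : D ⟶ P'} {m : P' ⟶ P}
    (hmid : k ≫ eqToHom e ≫ t.hom = eqToHom e' ≫ α ≫ m) {e₁ : D' = D} {t' : D' ⟶ P'}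
    (hfull : t' = eqToHom e₁ ≫ α) (e₂ : B = B') (e₃ : B' = D') {l : B' ⟶ A'}
    (hl : l = eqToHom e₃ ≫ t' ≫ m ≫ t.inv) : k ≫ eqToHom e = eqToHom e₂ ≫ l := by
  subst e₁ e₃ e₂ e
  simp only [eqToHom_refl, Category.id_comp, Category.comp_id] at *
  rw [hl, hfull, ← reassoc_of% hmid, Iso.hom_inv_id, Category.comp_id]

/-- A functor on the intervals of `[n] ⋆ [1]` is determined by its last edge, its base, its last
face and the arrows from intervals that contain the last edge to the intervals that contain only
its source. -/
lemma eq_of_faces {K K' : Intervals (join ⦋n⦌ ⦋1⦌) ⥤ Arrow FintypeCat.{u}}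
    (hK : PullbackProperty K)
    (hE : LeftLegIso (Intervals.functor (joinInr ⦋n⦌ ⦋1⦌) ⋙ K))
    (hE' : RightSquare (Intervals.functor (joinInr ⦋n⦌ ⦋1⦌) ⋙ K))
    (e : K ⋙ Arrow.rightFunc = K' ⋙ Arrow.rightFunc)
    (eδ : Intervals.functor (lastFace n) ⋙ K = Intervals.functor (lastFace n) ⋙ K')
    (eℓ : Intervals.functor (joinInr ⦋n⦌ ⦋1⦌) ⋙ K = Intervals.functor (joinInr ⦋n⦌ ⦋1⦌) ⋙ K')
    (hobj : ∀ I : Intervals (join ⦋n⦌ ⦋1⦌), (∃ y, (lastFace n).toOrderHom y = I.lo) →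
      I.hi = (joinInr ⦋n⦌ ⦋1⦌).toOrderHom 0 → K.obj I = K'.obj I)
    (hmap : ∀ (h : ∀ I, K.obj I = K'.obj I) (I : Intervals (join ⦋n⦌ ⦋1⦌)),
      (∃ y, (lastFace n).toOrderHom y = I.lo) → I.hi = (joinInr ⦋n⦌ ⦋1⦌).toOrderHom 0 →
      LeftNatural h ((Intervals.extendTo (lastFaceRetract n ≫ lastFace n)
        (le_lastFace_retract n)).app I)) : K = K' := by
  have h (I) : K.obj I = K'.obj I := by
    obtain ⟨x, hx⟩ | hlo := lastFace_cover n I.lo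
    · obtain ⟨y, hy⟩ | hhi := lastFace_cover n I.hi
      · obtain ⟨I, rfl⟩ := exists_functor_obj _ (lastFace_injective n) hx hy
        exact Functor.congr_obj eδ I
      · exact hobj I ⟨x, hx⟩ hhi
    · obtain hhi | hhi := eq_of_joinInr_zero_le n I.hi (hlo ▸ I.lo_le_hi)
      all_goals
        obtain ⟨I, rfl⟩ := exists_functor_obj _ (joinInr_injective _ _) hlo.symm hhi.symm
        exact Functor.congr_obj eℓ I
  exact eq_of_last_faces (lastFace n) (lastFaceRetract n) (le_lastFace_retract n)
    (lastFace_comp_retract n) (joinInr ⦋n⦌ ⦋1⦌) (lastVertex n) (joinInr_one n)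
    (lastFaceRetract_joinInr n) (joinInr_injective _ _) (lastFace_cover n)
    (eq_of_joinInr_zero_le n) hK hE hE' e eδ eℓ h (hmap h)

lemma exists_lo_eq {I : Intervals (join ⦋n⦌ ⦋1⦌)} (h : ∃ y, (lastFace n).toOrderHom y = I.lo)
    (h' : I.hi = (joinInr ⦋n⦌ ⦋1⦌).toOrderHom 0) : ∃ x : Fin (n + 1), I.lo.1 = x.1 := by
  obtain ⟨y, hy⟩ := h
  have h1 : I.lo ≠ (joinInr ⦋n⦌ ⦋1⦌).toOrderHom 0 := hy ▸ lastFace_ne_zero y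
  have h2 : I.lo.1 ≤ n + 1 := Fin.le_def.1 (I.lo_le_hi.trans h'.le)
  have h3 : I.lo.1 ≠ n + 1 := fun h => h1 (Fin.ext h)
  exact ⟨⟨I.lo.1, by omega⟩, rfl⟩

/-- A functor on the intervals of `[0] ⋆ [1]` is determined by its last edge, its base, its last
face and the arrow from the full interval to the first edge. -/
lemma eq_of_midEdge {K K' : Intervals (join ⦋0⦌ ⦋1⦌) ⥤ Arrow FintypeCat.{u}}
    (hK : PullbackProperty K)
    (hE : LeftLegIso (Intervals.functor (joinInr ⦋0⦌ ⦋1⦌) ⋙ K))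
    (hE' : RightSquare (Intervals.functor (joinInr ⦋0⦌ ⦋1⦌) ⋙ K))
    (e : K ⋙ Arrow.rightFunc = K' ⋙ Arrow.rightFunc)
    (eδ : Intervals.functor (lastFace 0) ⋙ K = Intervals.functor (lastFace 0) ⋙ K')
    (eℓ : Intervals.functor (joinInr ⦋0⦌ ⦋1⦌) ⋙ K = Intervals.functor (joinInr ⦋0⦌ ⦋1⦌) ⋙ K')
    (hmid : K.obj midEdge = K'.obj midEdge)
    (hmap : (K.map fullToMid).left ≫ eqToHom (congrArg Comma.left hmid) =
      eqToHom (congrArg Comma.left (Functor.congr_obj eδ fullEdge)) ≫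
        (K'.map fullToMid).left) : K = K' := by
  have hmid' {I : Intervals (join ⦋0⦌ ⦋1⦌)} (h : ∃ y, (lastFace 0).toOrderHom y = I.lo)
      (h' : I.hi = (joinInr ⦋0⦌ ⦋1⦌).toOrderHom 0) : I = midEdge := by
    obtain ⟨x, hx⟩ := exists_lo_eq h h'
    exact Intervals.ext (Fin.ext (hx.trans (Nat.lt_one_iff.1 x.2))) h'
  refine eq_of_faces hK hE hE' e eδ eℓ (fun I hI hI' => ?_) (fun h I hI hI' => ?_)
  · obtain rfl := hmid' hI hI'
    exact hmid
  obtain rfl := hmid' hI hI'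
  have hc : (Intervals.extendTo (lastFaceRetract 0 ≫ lastFace 0) (le_lastFace_retract 0)).app
      midEdge = homOfLE extend_midEdge.le ≫ fullToMid := rfl
  rw [hc]
  refine LeftNatural.comp (LeftNatural.of_eq _ extend_midEdge) ?_
  unfold LeftNatural
  rw [Arrow.eqToHom_left, Arrow.eqToHom_left]
  exact hmap

/-- A functor on the intervals of `[n] ⋆ [1]` is determined by its last edge, its base, its last
face and its restrictions along vertices of `[n]`. -/
lemma eq_of_vertexJoin {K K' : Intervals (join ⦋n⦌ ⦋1⦌) ⥤ Arrow FintypeCat.{u}}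
    (hK : PullbackProperty K)
    (hE : LeftLegIso (Intervals.functor (joinInr ⦋n⦌ ⦋1⦌) ⋙ K))
    (hE' : RightSquare (Intervals.functor (joinInr ⦋n⦌ ⦋1⦌) ⋙ K))
    (e : K ⋙ Arrow.rightFunc = K' ⋙ Arrow.rightFunc)
    (eδ : Intervals.functor (lastFace n) ⋙ K = Intervals.functor (lastFace n) ⋙ K')
    (eℓ : Intervals.functor (joinInr ⦋n⦌ ⦋1⦌) ⋙ K = Intervals.functor (joinInr ⦋n⦌ ⦋1⦌) ⋙ K')
    (ev : ∀ x, Intervals.functor (vertexJoin n x) ⋙ K =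
      Intervals.functor (vertexJoin n x) ⋙ K') : K = K' := by
  have hmid {I : Intervals (join ⦋n⦌ ⦋1⦌)} (h : ∃ y, (lastFace n).toOrderHom y = I.lo)
      (h' : I.hi = (joinInr ⦋n⦌ ⦋1⦌).toOrderHom 0) :
      ∃ x, I = (Intervals.functor (vertexJoin n x)).obj midEdge := by
    obtain ⟨x, hx⟩ := exists_lo_eq h h'
    exact ⟨x, Intervals.ext (Fin.ext (hx.trans (lo_midEdge_image x).symm))
      (h'.trans (hi_midEdge_image x).symm)⟩
  refine eq_of_faces hK hE hE' e eδ eℓ (fun I hI hI' => ?_) (fun h I hI hI' => ?_)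
  · obtain ⟨x, rfl⟩ := hmid hI hI'
    exact Functor.congr_obj (ev x) midEdge
  obtain ⟨x, rfl⟩ := hmid hI hI'
  have hI : (Intervals.extend (lastFaceRetract n ≫ lastFace n) (le_lastFace_retract n)).obj
      ((Intervals.functor (vertexJoin n x)).obj midEdge) =
      (Intervals.functor (vertexJoin n x)).obj ((Intervals.functor (lastFace 0)).obj fullEdge) := by
    refine Intervals.ext ?_ ?_
    · exact congrArg (vertexJoin n x).toOrderHom (congrArg Intervals.lo extend_midEdge)
    · refine Eq.trans ?_ (congrArg Intervals.hi (functor_vertexJoin_obj x fullEdge))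
      refine congrArg (lastFace n).toOrderHom ?_
      rw [hi_midEdge_image, lastFaceRetract_joinInr]
      exact (joinMap_joinInr_apply (vertex (n := ⦋n⦌) x) (𝟙 ⦋0⦌) 0).symm
  have hc : (Intervals.extendTo (lastFaceRetract n ≫ lastFace n) (le_lastFace_retract n)).app
      ((Intervals.functor (vertexJoin n x)).obj midEdge) =
        homOfLE hI.le ≫ (Intervals.functor (vertexJoin n x)).map fullToMid := rfl
  rw [hc]
  exact LeftNatural.comp (LeftNatural.of_eq _ hI) (LeftNatural.of_comp_eq (ev x) fullToMid)

/-- The domains are those of `cartLift`, with values replaced so as to match G, F and the prescribed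
K strictly. The set V of vertices with prescribed lifts serves to cover both the lifting of a bare
vertex and the filling of a simplex with all its vertices given. -/
theorem exists_filler (hF1 : RightSquare F) (hF2 : LeftLegIso F)
    {G : Intervals (join ⦋n⦌ ⦋0⦌) ⥤ Arrow FintypeCat.{u}} (hG : PullbackProperty G)
    {Y : Intervals (join ⦋n⦌ ⦋1⦌) ⥤ FintypeCat.{u}} (hY : PullbackProperty Y)
    (hGF : Intervals.functor (joinInr ⦋n⦌ ⦋0⦌) ⋙ G =
      Intervals.functor (SimplexCategory.δ 0) ⋙ F)
    (hFY : F ⋙ Arrow.rightFunc = Intervals.functor (joinInr ⦋n⦌ ⦋1⦌) ⋙ Y)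
    (hGY : G ⋙ Arrow.rightFunc = Intervals.functor (lastFace n) ⋙ Y)
    (V : Set (Fin (n + 1))) (K : V → Intervals (join ⦋0⦌ ⦋1⦌) ⥤ Arrow FintypeCat.{u})
    (hK : ∀ x, PullbackProperty (K x))
    (hKF : ∀ x, Intervals.functor (joinInr ⦋0⦌ ⦋1⦌) ⋙ K x = F)
    (hKG : ∀ x : V, Intervals.functor (lastFace 0) ⋙ K x =
      Intervals.functor (vertexJoinZero n x) ⋙ G)
    (hKY : ∀ x : V, K x ⋙ Arrow.rightFunc = Intervals.functor (vertexJoin n x) ⋙ Y) :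
    ∃ H : Intervals (join ⦋n⦌ ⦋1⦌) ⥤ Arrow FintypeCat.{u}, PullbackProperty H ∧
      Intervals.functor (lastFace n) ⋙ H = G ∧ Intervals.functor (joinInr ⦋n⦌ ⦋1⦌) ⋙ H = F ∧
      H ⋙ Arrow.rightFunc = Y ∧ ∀ x : V, Intervals.functor (vertexJoin n x) ⋙ H = K x := by
  obtain ⟨X, π, rfl⟩ := exists_arrowFunctor G hGY
  obtain ⟨Z, φ, rfl⟩ := exists_arrowFunctor F hFY
  choose XK ψ hψ using fun x : V => exists_arrowFunctor (K x) (hKY x)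
  obtain rfl : K = fun x => arrowFunctor (ψ x) := funext hψ
  have hX : PullbackProperty X := hG.comp Arrow.leftFunc
  obtain ⟨h, hw⟩ := arrow_mk_eq Y (lastToPoint (lastFace n) (joinInr ⦋n⦌ ⦋1⦌) (lastVertex n)
    (joinInr_one n)) (Intervals.ext (joinInr_one n) (joinInr_one n))
    (f := φ.app lastOne) (g := π.app (.point (lastVertex n)))
    (Functor.congr_obj hGF (.point 0)).symm
  have hKX (x : V) := arrow_mk_eq Y
    (homOfLE (functor_vertexJoin_obj x.1 fullEdge).ge) (functor_vertexJoin_obj x.1 fullEdge).symm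
    (f := (ψ x).app ((Intervals.functor (lastFace 0)).obj fullEdge))
    (g := π.app ((Intervals.functor (vertexJoinZero n x)).obj fullEdge))
    (Functor.congr_obj (hKG x) fullEdge)
  choose hKX1 hKX2 using hKX
  -- In a prescribed lift, the middle value is isomorphic to the one at the full interval, because
  -- the left leg of F is invertible on domains.
  have hKiso (x : V) : IsIso ((XK x).map fullToMid) := by
    have h1 := isIso_map_extendTo (lastFace 0) (lastFaceRetract 0) (le_lastFace_retract 0)
      (lastFace_comp_retract 0) (joinInr ⦋0⦌ ⦋1⦌) (lastVertex 0) (joinInr_one 0)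
      (lastFaceRetract_joinInr 0) (lastFace_cover 0) (hK x) (by rw [hKF]; exact hF2) midEdge
    have h2 := isIso_map_of_eq (XK x) (homOfLE extend_midEdge.ge) extend_midEdge.symm
    have h3 : (XK x).map fullToMid = (XK x).map (homOfLE extend_midEdge.ge) ≫
        (XK x).map ((Intervals.extendTo (lastFaceRetract 0 ≫ lastFace 0)
          (le_lastFace_retract 0)).app midEdge) := ((XK x).map_comp _ _)
    rw [h3]
    exact @IsIso.comp_isIso _ _ _ _ _ _ _ h2 h1
  have hPiso (x : V) : IsIso ((cartLift (lastFace n) (lastFaceRetract n) (le_lastFace_retract n)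
      π).map (fullToMidVertex x.1)) := by
    have hlo : ((Intervals.functor (lastFace n)).obj
        ((Intervals.functor (vertexJoinZero n x.1)).obj fullEdge)).lo =
          ((Intervals.functor (vertexJoin n x.1)).obj midEdge).lo :=
      (congrArg Intervals.lo (functor_vertexJoin_obj x.1 fullEdge)).trans
        (congrArg (vertexJoin n x.1).toOrderHom (congrArg Intervals.lo extend_midEdge).symm)
    refine isIso_cartLift_map _ _ _ _ _ (congrArg _ hlo) ?_ hlo
    rw [hi_midEdge_image, lastFaceRetract_joinInr, Intervals.hi_functor,
      retract_apply _ _ (lastFace_comp_retract n)]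
    exact joinMap_joinInr_apply (vertex (n := ⦋n⦌) x.1) (𝟙 ⦋0⦌) 0
  have hF1' : IsPullbackRight (joinInr ⦋n⦌ ⦋1⦌) φ := hF1
  have hF2' : IsIsoLeft Z := hF2
  obtain ⟨s, hs1, hs2, hs3⟩ := exists_cartSection (lastFace n) (lastFaceRetract n)
    (le_lastFace_retract n) π (joinInr ⦋n⦌ ⦋1⦌) (lastVertex n) (joinInr_one n)
    (lastFaceRetract_joinInr n) φ hF1' hF2' (lastFace_comp_retract n) (joinInr_injective _ _)
    h.symm (by simpa using hw.symm)
    (fun x : V => (Intervals.functor (vertexJoin n x)).obj midEdge)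
    (midEdge_image_injective.comp Subtype.val_injective)
    (fun x => functor_lastFace_ne x.1) (fun x => functor_joinInr_ne x.1)
    -- The middle value of K is identified with that of `cartLift` through the full interval, which
    -- belongs to the last face, where both are already identified with X. This choice makes the map
    -- from the full to the middle interval come out as in K.
    (fun x => ⟨(XK x).obj midEdge, (asIso ((XK x).map fullToMid)).symm ≪≫ eqToIso (hKX1 x) ≪≫
      (isoCartLift _ _ _ π (lastFace_comp_retract n)).app _ ≪≫
      asIso ((cartLift _ _ _ π).map (fullToMidVertex x.1))⟩)
  have hsδ := comp_arrowFunctor_transport (cartProj _ _ _ π) s _ _ hs1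
  rw [isoCartLift_proj] at hsδ
  have hsℓ := comp_arrowFunctor_transport (cartProj _ _ _ π) s _ _ hs2
  rw [edgeIsoCartLift_proj] at hsℓ
  refine ⟨arrowFunctor ((transportIso _ s).hom ≫ cartProj _ _ _ π),
    pullbackProperty_arrowFunctor _ ((pullbackProperty_cartLift _ _ _ π hX hY).of_iso
      (transportIso _ s).symm) hY, hsδ, hsℓ, rfl, fun x => ?_⟩
  generalize hH : arrowFunctor ((transportIso _ s).hom ≫ cartProj _ _ _ π) = H at hsδ hsℓ
  have hmid := sigma_iso_comp (hs3 x)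
  have hfull := sigma_iso_hom (hs1 ((Intervals.functor (vertexJoinZero n x)).obj fullEdge))
  -- Base, last face and last edge agree already, so only the middle value and the map into it
  -- remain.
  refine (eq_of_midEdge (K' := Intervals.functor (vertexJoin n x) ⋙ H) (hK x)
    (by rw [hKF]; exact hF2) (by rw [hKF]; exact hF1) (by rw [← hH]; rfl)
    ((hKG x).trans ((congrArg (Intervals.functor (vertexJoinZero n x) ⋙ ·) hsδ.symm).trans
      (functor_comp_congr (lastFace_vertexJoin x.1).symm H)))
    ((hKF x).trans (hsℓ.symm.trans (functor_comp_congr (θ := 𝟙 _)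
      (joinInr_joinMap (vertex (n := ⦋n⦌) x) (𝟙 ⦋1⦌)).symm H))) ?_ ?_).symm
  · subst hH
    refine arrow_mk_congr (congrArg Sigma.fst (hs3 x)).symm ?_
    have := hKiso x
    exact eq_eqToHom_comp_of_mid hmid
      ((cartProj _ _ (le_lastFace_retract n) π).naturality (fullToMidVertex x.1))
      (NatTrans.congr_app (isoCartLift_proj _ _ (le_lastFace_retract n) π
        (lastFace_comp_retract n)) ((Intervals.functor (vertexJoinZero n x)).obj fullEdge))
      (hKX2 x) (Y.map_comp _ _) ((ψ x).naturality fullToMid)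
  · subst hH
    have e := (functor_vertexJoin_obj x.1 fullEdge).symm
    have h1 := (transport _ s).map_comp (homOfLE e.le) (fullToMidVertex x.1)
    rw [map_eq_eqToHom (transport _ s) (homOfLE e.le) e] at h1
    exact comp_eqToHom_of_mid hmid hfull _ _ h1

end Filler

end SpanQuasi

/-! ### Edges of the required shape are cartesian. -/

namespace SpanQuasi

open Functor SSetSlice

/-- An edge of `Span^×` whose right square is a pullback and whose left leg is an isomorphism on
domains is cartesian. -/
theorem isCartesian_of_rightSquare (F : SpanTimes.{u} _⦋1⦌) (h1 : RightSquare F.1)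
    (h2 : LeftLegIso F.1) : IsCartesian proj.{u} F := by
  refine isAcyclicKanFibration_of_vertices _ _ _ _ _ (fun x y hxy => ?_)
    (fun n x y hxy z hz hz' => ?_) (fun n s s' hs hs' hv => ?_)
  -- Nothing is prescribed in lifting a vertex, hence the empty set; in the next case all vertices
  -- are prescribed.
  · obtain ⟨H, hH, e1, e2, e3, -⟩ := exists_filler h1 h2 (n := 0) x.1.2 y.1.2
      (congrArg Subtype.val x.2) (congrArg Subtype.val y.2).symm
      (congrArg (fun t => t.1.1) hxy) ∅ (fun x => x.2.elim) (fun x => x.2.elim)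
      (fun x => x.2.elim) (fun x => x.2.elim) (fun x => x.2.elim)
    exact ⟨⟨⟨H, hH⟩, Subtype.ext e2⟩, Subtype.ext (Subtype.ext e1), Subtype.ext (Subtype.ext e3)⟩
  · obtain ⟨H, hH, e1, e2, e3, e4⟩ := exists_filler h1 h2 (n := n) x.1.2 y.1.2
      (congrArg Subtype.val x.2) (congrArg Subtype.val y.2).symm
      (congrArg (fun t => t.1.1) hxy) Set.univ (fun a => (z a).1.1) (fun a => (z a).1.2)
      (fun a => congrArg Subtype.val (z a).2) (fun a => congrArg (fun t => t.1.1) (hz a))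
      (fun a => congrArg (fun t => t.1.1) (hz' a))
    exact ⟨⟨⟨H, hH⟩, Subtype.ext e2⟩, Subtype.ext (Subtype.ext e1), Subtype.ext (Subtype.ext e3),
      fun a => Subtype.ext (Subtype.ext (e4 ⟨a, trivial⟩))⟩
  · have e : Intervals.functor (joinInr ⦋n⦌ ⦋1⦌) ⋙ s.1.1 = F.1 := congrArg Subtype.val s.2
    have e' : Intervals.functor (joinInr ⦋n⦌ ⦋1⦌) ⋙ s'.1.1 = F.1 := congrArg Subtype.val s'.2
    exact Subtype.ext (Subtype.ext (eq_of_vertexJoin s.1.2 (by rw [e]; exact h2)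
      (by rw [e]; exact h1) (congrArg (fun t => t.1.1) hs') (congrArg (fun t => t.1.1) hs)
      (e.trans e'.symm) fun a => congrArg (fun t => t.1.1) (hv a)))

end SpanQuasi

/-! ### Existence of lifts of the required shape. -/

namespace SpanQuasi

open Functor SSetSlice

lemma isPullback_conj {C : Type u} [Category.{v} C] {A A' B B' D E : C} {f : A ⟶ B} {g : A ⟶ D}
    {h : B ⟶ E} {k : D ⟶ E} (H : IsPullback f g h k) (α : A' ≅ A) (β : B' ≅ B) :
    IsPullback (α.hom ≫ f ≫ β.inv) (α.hom ≫ g) (β.hom ≫ h) k :=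
  H.of_iso α.symm β.symm (Iso.refl _) (Iso.refl _) (by simp) (by simp) (by simp) (by simp)

/-- When I⁺ = I, the second factor of `cartLift` is Y(I) itself, so the projection to the base is a
base change of π. -/
lemma isPullback_cartProj {a c : SimplexCategory} (δ : c ⟶ a) (r : a ⟶ c)
    (hr : ∀ x, x ≤ (r ≫ δ).toOrderHom x) {X : Intervals c ⥤ FintypeCat.{u}}
    {Y : Intervals a ⥤ FintypeCat.{u}} (π : X ⟶ Intervals.functor δ ⋙ Y) {I : Intervals a}
    (hI : (Intervals.extend (r ≫ δ) hr).obj I = I)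
    (f : I ⟶ (Intervals.functor δ).obj ((Intervals.functor r).obj I)) :
    IsPullback ((cartFst δ r hr π).app I) ((cartProj δ r hr π).app I)
      (π.app ((Intervals.functor r).obj I)) (Y.map f) := by
  have := isIso_map_of_eq Y ((Intervals.extendTo (r ≫ δ) hr).app I) hI
  refine (isPullback_cartLift δ r hr π I).of_iso (Iso.refl _) (Iso.refl _)
    (asIso (Y.map ((Intervals.extendTo (r ≫ δ) hr).app I))) (Iso.refl _) ?_ ?_ ?_ ?_
  · exact (Category.comp_id _).trans (Category.id_comp _).symm
  · exact (Category.id_comp _).symm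
  · exact (Category.comp_id _).trans (Category.id_comp _).symm
  · exact (Category.comp_id _).trans ((congrArg Y.map (Subsingleton.elim _ _)).trans
      (Y.map_comp _ _))

/-- Every edge of the base can be lifted with given target to an edge whose right square is a
pullback and whose left leg is an isomorphism on domains. -/
lemma exists_rightSquare_lift {G : Intervals ⦋0⦌ ⥤ Arrow FintypeCat.{u}}
    {Y : Intervals ⦋1⦌ ⥤ FintypeCat.{u}} (hG : PullbackProperty G) (hY : PullbackProperty Y)
    (hGY : G ⋙ Arrow.rightFunc = Intervals.functor (SimplexCategory.δ 0) ⋙ Y) :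
    ∃ F : Intervals ⦋1⦌ ⥤ Arrow FintypeCat.{u}, PullbackProperty F ∧
      Intervals.functor (SimplexCategory.δ 0) ⋙ F = G ∧ F ⋙ Arrow.rightFunc = Y ∧
      RightSquare F ∧ LeftLegIso F := by
  obtain ⟨X, π, rfl⟩ := exists_arrowFunctor G hGY
  have hX : PullbackProperty X := hG.comp Arrow.leftFunc
  have hδ : SimplexCategory.δ 0 ≫ SimplexCategory.σ (n := 0) 0 = 𝟙 _ :=
    SimplexCategory.δ_comp_σ_self
  have hr (x) : x ≤ (SimplexCategory.σ (n := 0) 0 ≫ SimplexCategory.δ 0).toOrderHom x :=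
    (Fin.le_last x).trans (one_le_apply x)
  have hinj : Function.Injective
      (Intervals.functor (SimplexCategory.δ (n := 0) 0)).obj := by
    intro J J' h
    exact functor_injective _ (fun x y _ => Subsingleton.elim (α := Fin 1) x y) h
  let P := cartLift (SimplexCategory.δ 0) (SimplexCategory.σ 0) hr π
  have : ∀ I, Nonempty (Σ Z : FintypeCat.{u}, Z ≅ P.obj I) := fun I => ⟨⟨_, Iso.refl _⟩⟩
  obtain ⟨s, hs⟩ := exists_section (T := fun I => Σ Z : FintypeCat.{u}, Z ≅ P.obj I)
    (Intervals.functor (SimplexCategory.δ (n := 0) 0)).obj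
    (fun J => ⟨X.obj J, (isoCartLift _ _ hr π hδ).app J⟩) (fun J J' h => by rw [hinj h])
  have hsδ := comp_arrowFunctor_transport (cartProj _ _ hr π) s _ _ hs
  rw [isoCartLift_proj] at hsδ
  refine ⟨arrowFunctor ((transportIso P s).hom ≫ cartProj _ _ hr π),
    pullbackProperty_arrowFunctor _ ((pullbackProperty_cartLift _ _ hr π hX hY).of_iso
      (transportIso _ s).symm) hY, hsδ, rfl, fun I => ?_, fun I => ?_⟩
  · have hext (J : Intervals ⦋1⦌) (hJ : J.hi = 1) : extendOne.obj J = J :=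
      Intervals.ext rfl ((le_antisymm (Fin.le_last _) (one_le_apply _)).trans hJ.symm)
    have hle (J : Intervals ⦋1⦌) (hJ : J.hi = 1) : J ≤ (Intervals.functor
        (SimplexCategory.δ 0)).obj ((Intervals.functor (SimplexCategory.σ 0)).obj J) :=
      Intervals.le_iff.2 ⟨hr _, (le_antisymm (Fin.le_last _) (one_le_apply _)).trans hJ.symm |>.le⟩
    have h1 : (extendOne.obj I).hi = 1 := le_antisymm (Fin.le_last _) (one_le_apply _)
    have hσ : (Intervals.functor (SimplexCategory.σ 0)).obj (extendOne.obj I) =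
        (Intervals.functor (SimplexCategory.σ 0)).obj lastOne :=
      Intervals.ext (Subsingleton.elim (α := Fin 1) _ _) (Subsingleton.elim (α := Fin 1) _ _)
    have hP1 := isPullback_cartProj _ _ hr π (hext _ h1) (homOfLE (hle _ h1))
    have hP2 := isPullback_cartProj _ _ hr π (hext lastOne rfl) (homOfLE (hle _ rfl))
    have := isIso_map_of_eq X ((Intervals.functor (SimplexCategory.σ 0)).map (extendOneRes I)) hσ
    have := isIso_map_of_eq Y ((Intervals.functor (SimplexCategory.δ 0)).map
      ((Intervals.functor (SimplexCategory.σ 0)).map (extendOneRes I))) (congrArg _ hσ)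
    have hP3 := hP1.of_iso (Iso.refl _)
      (asIso (X.map ((Intervals.functor (SimplexCategory.σ 0)).map (extendOneRes I))))
      (Iso.refl _) (asIso (Y.map ((Intervals.functor (SimplexCategory.δ 0)).map
        ((Intervals.functor (SimplexCategory.σ 0)).map (extendOneRes I)))))
      (fst' := P.map (extendOneRes I) ≫ (cartFst _ _ hr π).app lastOne)
      (snd' := (cartProj _ _ hr π).app _)
      (f' := π.app ((Intervals.functor (SimplexCategory.σ 0)).obj lastOne))
      (g' := Y.map (extendOneRes I) ≫ Y.map (homOfLE (hle lastOne rfl)))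
      ((Category.id_comp _).trans ((cartFst _ _ hr π).naturality (extendOneRes I))).symm
      ((Category.comp_id _).trans (Category.id_comp _).symm)
      (π.naturality ((Intervals.functor (SimplexCategory.σ 0)).map (extendOneRes I))).symm
      (((Y.map_comp _ _).symm.trans (congrArg Y.map (Subsingleton.elim _ _))).trans
        ((Y.map_comp _ _).trans (Category.id_comp _).symm))
    -- Over {0, 1} and over {1} the projection is a base change of the same map, so the square
    -- between them is a pullback by cancellation.
    have hP4 := hP3.of_right ((cartProj _ _ hr π).naturality (extendOneRes I)) hP2
    exact isPullback_conj hP4 (s _).2 (s _).2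
  -- Extension keeps the left end, and the retraction to a point identifies all right ends.
  · have := isIso_cartLift_map (SimplexCategory.δ 0) (SimplexCategory.σ 0) hr π
      (extendOneTo.app I) rfl (Subsingleton.elim (α := Fin 1) _ _) rfl
    change IsIso ((s _).2.hom ≫ P.map _ ≫ (s _).2.inv)
    infer_instance

end SpanQuasi

/-! ### Uniqueness of cartesian lifts, in terms of simplices. -/

namespace SSetSlice

section Cartesian

variable {X Y : SSet.{u}} {p : X ⟶ Y} {f f' : X _⦋1⦌}

lemma joinInr_zero_zero : joinInr ⦋0⦌ ⦋0⦌ = SimplexCategory.δ (n := 0) 0 := by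
  ext i; fin_cases i; rfl

lemma joinInr_zero_one : joinInr ⦋0⦌ ⦋1⦌ = SimplexCategory.δ (n := 1) 0 := by
  ext i; fin_cases i <;> rfl

lemma lastFace_zero : lastFace 0 = SimplexCategory.δ (n := 1) 1 := by
  ext i; fin_cases i <;> rfl

lemma lastFace_one : lastFace 1 = SimplexCategory.δ (n := 2) 2 := by
  ext i; fin_cases i <;> rfl

lemma joinInr_one_zero : joinInr ⦋1⦌ ⦋0⦌ =
    SimplexCategory.δ (n := 0) 0 ≫ SimplexCategory.δ (n := 1) 0 := by
  ext i; fin_cases i; rfl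

lemma joinInr_one_one : joinInr ⦋1⦌ ⦋1⦌ =
    SimplexCategory.δ (n := 1) 0 ≫ SimplexCategory.δ (n := 2) 0 := by
  ext i; fin_cases i <;> rfl

lemma joinMap_vertex_zero :
    joinMap (vertex (n := ⦋1⦌) 0) (𝟙 ⦋1⦌) = SimplexCategory.δ (n := 2) 1 := by
  ext i; fin_cases i <;> rfl

lemma joinMap_vertex_one :
    joinMap (vertex (n := ⦋1⦌) 1) (𝟙 ⦋1⦌) = SimplexCategory.δ (n := 2) 0 := by
  ext i; fin_cases i <;> rfl

lemma joinMap_vertex_zero_zero :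
    joinMap (vertex (n := ⦋1⦌) 0) (𝟙 ⦋0⦌) = SimplexCategory.δ (n := 1) 1 := by
  ext i; fin_cases i <;> rfl

lemma joinMap_vertex_one_zero :
    joinMap (vertex (n := ⦋1⦌) 1) (𝟙 ⦋0⦌) = SimplexCategory.δ (n := 1) 0 := by
  ext i; fin_cases i <;> rfl

/-- Two lifts of an edge with the same target, one of which is cartesian, are faces of a
`2`-simplex over a degenerate one. -/
lemma IsCartesian.exists_two_simplex (hf : IsCartesian p f) (h : p.app _ f' = p.app _ f)
    (ht : target f' = target f) : ∃ K : X _⦋2⦌, X.map (SimplexCategory.δ 0).op K = f ∧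
      X.map (SimplexCategory.δ 1).op K = f' ∧
      p.app _ K = Y.map (SimplexCategory.σ 0).op (p.app _ f) := by
  have hσ (i : Fin 2) (hi : SimplexCategory.δ i.castSucc ≫ SimplexCategory.σ (n := 1) 0 = 𝟙 _) :
      Y.map (SimplexCategory.δ i.castSucc).op (Y.map (SimplexCategory.σ 0).op (p.app _ f)) =
        p.app _ f := by
    rw [← Functor.map_comp_apply, ← op_comp, hi]
    simp
  have h0 := hσ 0 (SimplexCategory.δ_comp_σ_self (n := 1) (i := 0))
  have h1 := hσ 1 (SimplexCategory.δ_comp_σ_succ (n := 1) (i := 0))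
  obtain ⟨z, hz, hz'⟩ := IsAcyclicKanFibration.exists_vertex hf
    (⟨f', by rw [← ht]; exact congrArg (fun θ => X.map (Quiver.Hom.op θ) f') joinInr_zero_zero⟩ :
      (slice X (target f)) _⦋0⦌)
    (⟨Y.map (SimplexCategory.σ 0).op (p.app _ f), by
      rw [joinInr_zero_one]; exact h0⟩ : (slice Y (p.app _ f)) _⦋0⦌)
    (Subtype.ext (h.trans (Eq.symm ((congrArg (fun θ => Y.map (Quiver.Hom.op θ)
      (Y.map (SimplexCategory.σ 0).op (p.app _ f))) lastFace_zero).trans h1))))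
  refine ⟨z.1, ?_, ?_, congrArg Subtype.val hz'⟩
  · exact (congrArg (fun θ => X.map (Quiver.Hom.op θ) z.1) joinInr_zero_one.symm).trans z.2
  · exact (congrArg (fun θ => X.map (Quiver.Hom.op θ) z.1) lastFace_zero.symm).trans
      (congrArg Subtype.val hz)

/-- K' is an edge of the slice over the target of f whose ends are f and f'. These ends lift to the
degenerate simplex on f and to K in the slice over f, and lifting the edge between them, over a
doubly degenerate base simplex, gives M. -/
lemma IsCartesian.exists_three_simplex (hf : IsCartesian p f) (ht : target f' = target f)
    {K K' : X _⦋2⦌}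
    (hK0 : X.map (SimplexCategory.δ 0).op K = f) (hK1 : X.map (SimplexCategory.δ 1).op K = f')
    (hK0' : X.map (SimplexCategory.δ 0).op K' = f') (hK1' : X.map (SimplexCategory.δ 1).op K' = f)
    (hK : p.app _ K = Y.map (SimplexCategory.σ 0).op (p.app _ f))
    (hK' : p.app _ K' = Y.map (SimplexCategory.σ 0).op (p.app _ f)) :
    ∃ M : X _⦋3⦌, X.map (SimplexCategory.δ 0).op M = K ∧
      X.map (SimplexCategory.δ 1).op M = X.map (SimplexCategory.σ 0).op f ∧
      X.map (SimplexCategory.δ 2).op M = K' := by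
  have hσ (θ : ⦋2⦌ ⟶ ⦋3⦌) (hθ : θ ≫ SimplexCategory.σ (n := 2) 0 ≫ SimplexCategory.σ (n := 1) 0 =
      SimplexCategory.σ 0) : Y.map θ.op (Y.map (SimplexCategory.σ 0).op
        (Y.map (SimplexCategory.σ 0).op (p.app _ f))) =
        Y.map (SimplexCategory.σ 0).op (p.app _ f) := by
    rw [← Functor.map_comp_apply, ← Functor.map_comp_apply, ← op_comp, ← op_comp,
      Category.assoc, hθ]
  have hσ0 := hσ (SimplexCategory.δ 0) (by ext i; fin_cases i <;> rfl)
  have hσ1 := hσ (SimplexCategory.δ 1) (by ext i; fin_cases i <;> rfl)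
  have hσ2 := hσ (SimplexCategory.δ 2) (by ext i; fin_cases i <;> rfl)
  have hσf (θ : ⦋1⦌ ⟶ ⦋2⦌) (hθ : θ ≫ SimplexCategory.σ (n := 1) 0 = 𝟙 _) :
      X.map θ.op (X.map (SimplexCategory.σ 0).op f) = f := by
    rw [← Functor.map_comp_apply, ← op_comp, hθ]
    simp
  have hf0 := hσf (SimplexCategory.δ 0) (by ext i; fin_cases i <;> rfl)
  have hf1 := hσf (SimplexCategory.δ 1) (by ext i; fin_cases i <;> rfl)
  have hpf : p.app _ (X.map (SimplexCategory.σ 0).op f) =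
      Y.map (SimplexCategory.σ 0).op (p.app _ f) := NatTrans.naturality_apply p _ f
  let z0 : (slice X f) _⦋0⦌ := ⟨X.map (SimplexCategory.σ 0).op f, by
    rw [joinInr_zero_one]; exact hf0⟩
  let z1 : (slice X f) _⦋0⦌ := ⟨K, by rw [joinInr_zero_one]; exact hK0⟩
  have hx : X.map (joinInr ⦋1⦌ ⦋0⦌).op K' = target f := by
    rw [joinInr_one_zero, op_comp, Functor.map_comp_apply, hK0']
    exact ht
  have hy : Y.map (joinInr ⦋1⦌ ⦋1⦌).op (Y.map (SimplexCategory.σ 0).op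
        (Y.map (SimplexCategory.σ 0).op (p.app _ f))) = p.app _ f := by
    rw [joinInr_one_one, op_comp, Functor.map_comp_apply, hσ0]
    rw [← Functor.map_comp_apply, ← op_comp]
    exact (congrArg (fun θ => Y.map (Quiver.Hom.op θ) (p.app _ f))
      (SimplexCategory.δ_comp_σ_self (n := 1) (i := 0))).trans (by simp)
  obtain ⟨m, hm1, hm2, hm3⟩ := IsAcyclicKanFibration.exists_edge hf
    (⟨K', hx⟩ : (slice X (target f)) _⦋1⦌) (⟨_, hy⟩ : (slice Y (p.app _ f)) _⦋1⦌) (by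
      refine Subtype.ext ?_
      refine hK'.trans ?_
      exact hσ2.symm.trans (congrArg (fun θ => Y.map (Quiver.Hom.op θ) _) lastFace_one.symm))
    ![z0, z1] (fun a => by
      refine Subtype.ext ?_
      obtain rfl | rfl := eq_zero_or_one a
      · refine (congrArg (fun θ => X.map (Quiver.Hom.op θ) _) lastFace_zero).trans ?_
        refine (hf1.trans hK1'.symm).trans ?_
        exact (congrArg (fun θ => X.map (Quiver.Hom.op θ) K') joinMap_vertex_zero_zero.symm)
      · refine (congrArg (fun θ => X.map (Quiver.Hom.op θ) _) lastFace_zero).trans ?_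
        refine (hK1.trans hK0'.symm).trans ?_
        exact (congrArg (fun θ => X.map (Quiver.Hom.op θ) K') joinMap_vertex_one_zero.symm))
    (fun a => by
      refine Subtype.ext ?_
      obtain rfl | rfl := eq_zero_or_one a
      · refine hpf.trans (hσ1.symm.trans ?_)
        exact (congrArg (fun θ => Y.map (Quiver.Hom.op θ) _) joinMap_vertex_zero.symm)
      · refine hK.trans (hσ0.symm.trans ?_)
        exact (congrArg (fun θ => Y.map (Quiver.Hom.op θ) _) joinMap_vertex_one.symm))
  refine ⟨m.1, ?_, ?_, ?_⟩
  · refine (congrArg (fun θ => X.map (Quiver.Hom.op θ) m.1) joinMap_vertex_one.symm).trans ?_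
    exact congrArg Subtype.val (hm3 1)
  · refine (congrArg (fun θ => X.map (Quiver.Hom.op θ) m.1) joinMap_vertex_zero.symm).trans ?_
    exact congrArg Subtype.val (hm3 0)
  · refine (congrArg (fun θ => X.map (Quiver.Hom.op θ) m.1) lastFace_one.symm).trans ?_
    exact congrArg Subtype.val hm1

end Cartesian

end SSetSlice

namespace SSetSlice

lemma map_map_eq {X : SSet.{u}} {a b b' c : SimplexCategory} {θ : a ⟶ b}
    {φ : b ⟶ c} {θ' : a ⟶ b'} {φ' : b' ⟶ c} (h : θ ≫ φ = θ' ≫ φ') (x : X.obj (op c)) :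
    X.map θ.op (X.map φ.op x) = X.map θ'.op (X.map φ'.op x) := by
  rw [← Functor.map_comp_apply, ← Functor.map_comp_apply, ← op_comp, ← op_comp, h]

/-- The restriction of a `3`-simplex to its first three vertices, when its face opposite to the
second vertex is degenerate. -/
lemma exists_front_face {X : SSet.{u}} {M : X _⦋3⦌} {K K' : X _⦋2⦌} {f : X _⦋1⦌}
    (h0 : X.map (SimplexCategory.δ 0).op M = K)
    (h1 : X.map (SimplexCategory.δ 1).op M = X.map (SimplexCategory.σ 0).op f)
    (h2 : X.map (SimplexCategory.δ 2).op M = K') :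
    ∃ m : X _⦋2⦌, X.map (SimplexCategory.δ 2).op m = X.map (SimplexCategory.δ 2).op K' ∧
      X.map (SimplexCategory.δ 0).op m = X.map (SimplexCategory.δ 2).op K ∧
      X.map (SimplexCategory.δ 1).op m =
        X.map (SimplexCategory.σ 0).op (X.map (SimplexCategory.δ 1).op f) := by
  refine ⟨X.map (SimplexCategory.δ 3).op M, ?_, ?_, ?_⟩
  · rw [← h2]
    exact map_map_eq (by ext i; fin_cases i <;> rfl) _
  · rw [← h0]
    exact map_map_eq (by ext i; fin_cases i <;> rfl) _
  -- The edge from vertex 0 to vertex 2 also lies in the face opposite to vertex 1, which is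
  -- degenerate.
  · refine (map_map_eq (θ' := SimplexCategory.δ 2) (φ' := SimplexCategory.δ 1)
      (by ext i; fin_cases i <;> rfl) _).trans ?_
    rw [h1]
    exact map_map_eq (by ext i; fin_cases i <;> rfl) _

end SSetSlice

/-! ### Composites and inverses of spans. -/

namespace SpanQuasi

open Functor SSetSlice

section Legs

variable {C : Type u} [Category.{v} C]

lemma isSplitEpi_of_comp {A B D : C} (f : A ⟶ B) (g : B ⟶ D) [IsIso (f ≫ g)] : IsSplitEpi g :=
  ⟨⟨⟨inv (f ≫ g) ≫ f, by rw [Category.assoc, IsIso.inv_hom_id]⟩⟩⟩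

lemma isSplitMono_of_comp {A B D : C} (f : A ⟶ B) (g : B ⟶ D) [IsIso (f ≫ g)] : IsSplitMono f :=
  ⟨⟨⟨g ≫ inv (f ≫ g), by rw [← Category.assoc, IsIso.hom_inv_id]⟩⟩⟩

lemma isSplitEpi_fst {P A B D : C} {f : P ⟶ A} {g : P ⟶ B} {h : A ⟶ D} {k : B ⟶ D}
    (H : IsPullback f g h k) [IsSplitEpi k] : IsSplitEpi f :=
  ⟨⟨⟨H.lift (𝟙 _) (h ≫ section_ k) (by simp), H.lift_fst _ _ _⟩⟩⟩

/-- If the composite of a base change of a split epimorphism and another map is an isomorphism,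
then that map is an isomorphism. -/
lemma isIso_of_isPullback_of_comp {P A B D E : C} {f : P ⟶ A} {g : P ⟶ B} {h : A ⟶ D} {k : B ⟶ D}
    (H : IsPullback f g h k) [IsSplitEpi k] (l : A ⟶ E) [IsIso (f ≫ l)] : IsIso l := by
  have := isSplitEpi_fst H
  have := isSplitMono_of_comp f l
  have := isIso_of_epi_of_isSplitMono f
  exact IsIso.of_isIso_comp_left f l

/-- The interval `{i, …, j}` of `[2]`. -/
abbrev intervalTwo (i j : Fin 3) (h : i ≤ j) : Intervals ⦋2⦌ := Intervals.mk (a := ⦋2⦌) i j h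

variable (K : Span C _⦋2⦌)

/-- The apex of a `2`-simplex of `Span(C)` is the fibre product of the apices of two of its
edges. -/
lemma exists_isPullback_faces : ∃ (P A B D E E' : C) (f : P ⟶ A) (g : P ⟶ B) (h : A ⟶ D)
    (k : B ⟶ D) (l : A ⟶ E) (m : B ⟶ E'), IsPullback f g h k ∧
      Arrow.mk (edgeLeft ((Span C).map (SimplexCategory.δ 2).op K)) = Arrow.mk l ∧
      Arrow.mk (edgeRight ((Span C).map (SimplexCategory.δ 2).op K)) = Arrow.mk h ∧
      Arrow.mk (edgeLeft ((Span C).map (SimplexCategory.δ 0).op K)) = Arrow.mk k ∧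
      Arrow.mk (edgeRight ((Span C).map (SimplexCategory.δ 0).op K)) = Arrow.mk m ∧
      Arrow.mk (edgeLeft ((Span C).map (SimplexCategory.δ 1).op K)) = Arrow.mk (f ≫ l) ∧
      Arrow.mk (edgeRight ((Span C).map (SimplexCategory.δ 1).op K)) = Arrow.mk (g ≫ m) := by
  -- {0, 1, 2} is the union of {0, 1} and {1, 2}, which meet in {1}. Stating the faces as equalities
  -- of arrows lets properties of the legs be moved by `congrArg`.
  refine ⟨_, _, _, _, _, _,
    K.1.map (homOfLE (by decide) : intervalTwo 0 2 (by decide) ⟶ intervalTwo 0 1 (by decide)),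
    K.1.map (homOfLE (by decide) : intervalTwo 0 2 (by decide) ⟶ intervalTwo 1 2 (by decide)),
    K.1.map (homOfLE (by decide) : intervalTwo 0 1 (by decide) ⟶ intervalTwo 1 1 (by decide)),
    K.1.map (homOfLE (by decide) : intervalTwo 1 2 (by decide) ⟶ intervalTwo 1 1 (by decide)),
    K.1.map (homOfLE (by decide) : intervalTwo 0 1 (by decide) ⟶ intervalTwo 0 0 (by decide)),
    K.1.map (homOfLE (by decide) : intervalTwo 1 2 (by decide) ⟶ intervalTwo 2 2 (by decide)),
    K.2 _ _ _ _ ?_ ?_, rfl, rfl, rfl, rfl, ?_, ?_⟩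
  · ext i
    fin_cases i <;> simp [Intervals.mem_toSet] <;> decide
  · ext i
    fin_cases i <;> simp [Intervals.mem_toSet] <;> decide
  · rw [← K.1.map_comp]
    rfl
  · rw [← K.1.map_comp]
    rfl

variable {K}

lemma isSplitEpi_edgeLeft (h1 : IsIso (edgeLeft ((Span C).map (SimplexCategory.δ 1).op K))) :
    IsSplitEpi (edgeLeft ((Span C).map (SimplexCategory.δ 2).op K)) := by
  obtain ⟨P, A, B, D, E, E', f, g, h, k, l, m, H, e1, -, -, -, e5, -⟩ := exists_isPullback_faces K
  have : IsIso (f ≫ l) := (congrArg (fun a => IsIso a.hom) e5).mp h1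
  exact (congrArg (fun a => IsSplitEpi a.hom) e1).mpr (isSplitEpi_of_comp f l)

lemma isSplitEpi_edgeRight (h1 : IsIso (edgeRight ((Span C).map (SimplexCategory.δ 1).op K))) :
    IsSplitEpi (edgeRight ((Span C).map (SimplexCategory.δ 0).op K)) := by
  obtain ⟨P, A, B, D, E, E', f, g, h, k, l, m, H, -, -, -, e4, -, e6⟩ := exists_isPullback_faces K
  have : IsIso (g ≫ m) := (congrArg (fun a => IsIso a.hom) e6).mp h1
  exact (congrArg (fun a => IsSplitEpi a.hom) e4).mpr (isSplitEpi_of_comp g m)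

/-- The left leg of the composite is a base change of the second left leg followed by the first. Its
invertibility makes the base change a split mono, and the second hypothesis makes it a split epi. -/
lemma isIso_edgeLeft (h1 : IsIso (edgeLeft ((Span C).map (SimplexCategory.δ 1).op K)))
    (h0 : IsSplitEpi (edgeLeft ((Span C).map (SimplexCategory.δ 0).op K))) :
    IsIso (edgeLeft ((Span C).map (SimplexCategory.δ 2).op K)) := by
  obtain ⟨P, A, B, D, E, E', f, g, h, k, l, m, H, e1, -, e3, -, e5, -⟩ := exists_isPullback_faces K
  have : IsIso (f ≫ l) := (congrArg (fun a => IsIso a.hom) e5).mp h1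
  have : IsSplitEpi k := (congrArg (fun a => IsSplitEpi a.hom) e3).mp h0
  exact (congrArg (fun a => IsIso a.hom) e1).mpr (isIso_of_isPullback_of_comp H l)

lemma isIso_edgeRight (h1 : IsIso (edgeRight ((Span C).map (SimplexCategory.δ 1).op K)))
    (h2 : IsSplitEpi (edgeRight ((Span C).map (SimplexCategory.δ 2).op K))) :
    IsIso (edgeRight ((Span C).map (SimplexCategory.δ 0).op K)) := by
  obtain ⟨P, A, B, D, E, E', f, g, h, k, l, m, H, -, e2, -, e4, -, e6⟩ := exists_isPullback_faces K
  have : IsIso (g ≫ m) := (congrArg (fun a => IsIso a.hom) e6).mp h1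
  have : IsSplitEpi h := (congrArg (fun a => IsSplitEpi a.hom) e2).mp h2
  exact (congrArg (fun a => IsIso a.hom) e4).mpr (isIso_of_isPullback_of_comp H.flip m)

lemma isIso_edgeLeft_comp (h0 : IsIso (edgeLeft ((Span C).map (SimplexCategory.δ 0).op K)))
    (h2 : IsIso (edgeLeft ((Span C).map (SimplexCategory.δ 2).op K))) :
    IsIso (edgeLeft ((Span C).map (SimplexCategory.δ 1).op K)) := by
  obtain ⟨P, A, B, D, E, E', f, g, h, k, l, m, H, e1, -, e3, -, e5, -⟩ := exists_isPullback_faces K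
  have : IsIso l := (congrArg (fun a => IsIso a.hom) e1).mp h2
  have : IsIso k := (congrArg (fun a => IsIso a.hom) e3).mp h0
  have : IsIso f := H.isIso_fst_of_isIso
  exact (congrArg (fun a => IsIso a.hom) e5).mpr (inferInstanceAs (IsIso (f ≫ l)))

/-- The right square of the composite is the second one pasted with a base change of the first right
leg, whose horizontal maps are isomorphisms. -/
lemma isPullback_edgeRight_comp {K : Span (Arrow C) _⦋2⦌}
    (h2 : IsIso (edgeRight ((Span (Arrow C)).map (SimplexCategory.δ 2).op K)))
    (h0 : IsPullback (edgeRight ((Span (Arrow C)).map (SimplexCategory.δ 0).op K)).left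
      (edgeApex ((Span (Arrow C)).map (SimplexCategory.δ 0).op K)).hom
      (edgeTarget ((Span (Arrow C)).map (SimplexCategory.δ 0).op K)).hom
      (edgeRight ((Span (Arrow C)).map (SimplexCategory.δ 0).op K)).right) :
    IsPullback (edgeRight ((Span (Arrow C)).map (SimplexCategory.δ 1).op K)).left
      (edgeApex ((Span (Arrow C)).map (SimplexCategory.δ 1).op K)).hom
      (edgeTarget ((Span (Arrow C)).map (SimplexCategory.δ 1).op K)).hom
      (edgeRight ((Span (Arrow C)).map (SimplexCategory.δ 1).op K)).right := by
  obtain ⟨P, A, B, D, E, E', f, g, h, k, l, m, H, -, e2, -, e4, -, e6⟩ := exists_isPullback_faces K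
  have : IsIso h := (congrArg (fun a => IsIso a.hom) e2).mp h2
  have : IsIso g := H.isIso_snd_of_isIso
  let Q (a : Arrow (Arrow C)) : Prop :=
    IsPullback a.hom.left a.left.hom a.right.hom a.hom.right
  have hm : IsPullback m.left B.hom E'.hom m.right := (congrArg Q e4).mp h0
  refine (congrArg Q e6).mpr ?_
  exact (IsPullback.of_horiz_isIso ⟨Arrow.w g⟩).paste_horiz hm

/-- An edge of `Span(C)` that has an inverse on both sides is a span of isomorphisms. -/
lemma isIso_edge_of_inverse {m m' : Span C _⦋2⦌} {a b : Span C _⦋1⦌}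
    (hm2 : (Span C).map (SimplexCategory.δ 2).op m = b)
    (hm0 : (Span C).map (SimplexCategory.δ 0).op m = a)
    (hm2' : (Span C).map (SimplexCategory.δ 2).op m' = a)
    (hm0' : (Span C).map (SimplexCategory.δ 0).op m' = b)
    (hl : IsIso (edgeLeft ((Span C).map (SimplexCategory.δ 1).op m)))
    (hr : IsIso (edgeRight ((Span C).map (SimplexCategory.δ 1).op m)))
    (hl' : IsIso (edgeLeft ((Span C).map (SimplexCategory.δ 1).op m')))
    (hr' : IsIso (edgeRight ((Span C).map (SimplexCategory.δ 1).op m'))) :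
    IsIso (edgeLeft b) ∧ IsIso (edgeRight b) := by
  constructor
  -- One composite being invertible gives the split epi needed for the other: the left leg of a is
  -- split epi by m', and then m makes the left leg of b invertible. Right legs are dual.
  · rw [← hm2]
    refine isIso_edgeLeft hl ?_
    rw [hm0, ← hm2']
    exact isSplitEpi_edgeLeft hl'
  · rw [← hm0']
    refine isIso_edgeRight hr' ?_
    rw [hm2', ← hm0]
    exact isSplitEpi_edgeRight hr

lemma isIso_edge_degenerate (x : Span C _⦋0⦌) :
    IsIso (edgeLeft ((Span C).map (SimplexCategory.σ 0).op x)) ∧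
      IsIso (edgeRight ((Span C).map (SimplexCategory.σ 0).op x)) :=
  ⟨isIso_map_of_eq x.1 _ (Intervals.ext (Subsingleton.elim (α := Fin 1) _ _)
    (Subsingleton.elim (α := Fin 1) _ _)), isIso_map_of_eq x.1 _ (Intervals.ext
    (Subsingleton.elim (α := Fin 1) _ _) (Subsingleton.elim (α := Fin 1) _ _))⟩

end Legs

/-- A cartesian edge of `Span^×` has a pullback square on the right and an isomorphism as the
left leg on domains. -/
theorem isPullback_and_isIso_of_isCartesian {F : SpanTimes.{u} _⦋1⦌}
    (hF : IsCartesian proj.{u} F) : IsPullback (edgeRight F).left (edgeApex F).hom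
      (edgeTarget F).hom (edgeRight F).right ∧ IsIso (edgeLeft F).left := by
  obtain ⟨H, hH, ht, hp, hH1, hH2⟩ := exists_rightSquare_lift (target F).2
    (Y := F.1 ⋙ Arrow.rightFunc) (proj.{u}.app _ F).2 rfl
  let F' : SpanTimes.{u} _⦋1⦌ := ⟨H, hH⟩
  have hF' : IsCartesian proj.{u} F' := isCartesian_of_rightSquare F' hH1 hH2
  have ht' : target F' = target F := Subtype.ext ht
  have hp' : proj.{u}.app _ F' = proj.{u}.app _ F := Subtype.ext hp
  obtain ⟨K, hK0, hK1, hK⟩ := hF.exists_two_simplex hp' ht'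
  obtain ⟨K', hK0', hK1', hK'⟩ := hF'.exists_two_simplex hp'.symm ht'.symm
  obtain ⟨M, hM0, hM1, hM2⟩ := hF.exists_three_simplex ht' hK0 hK1 hK0' hK1' hK (by rw [hK', hp'])
  obtain ⟨M', hM0', hM1', hM2'⟩ := hF'.exists_three_simplex ht'.symm hK0' hK1' hK0 hK1 hK'
    (by rw [hK, hp'])
  obtain ⟨m, hm2, hm0, hm1⟩ := exists_front_face hM0 hM1 hM2
  obtain ⟨m', hm2', hm0', hm1'⟩ := exists_front_face hM0' hM1' hM2'
  -- The first edges of K and K' are inverse to each other, as both composites are degenerate. By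
  -- K', F is the composite of an invertible edge with F'.
  obtain ⟨hl, hr⟩ := isIso_edge_of_inverse hm2 hm0 hm2' hm0'
    (by rw [hm1]; exact (isIso_edge_degenerate _).1) (by rw [hm1]; exact (isIso_edge_degenerate _).2)
    (by rw [hm1']; exact (isIso_edge_degenerate _).1)
    (by rw [hm1']; exact (isIso_edge_degenerate _).2)
  refine ⟨?_, ?_⟩
  · rw [← hK1']
    refine isPullback_edgeRight_comp (C := FintypeCat.{u}) hr ?_
    rw [hK0']
    exact (rightSquare_iff F').1 hH1
  · have h0 : IsIso (edgeLeft (SpanTimes.{u}.map (SimplexCategory.δ 0).op K')).left := by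
      rw [hK0']
      exact (leftLegIso_iff F').1 hH2
    have h2 : IsIso (edgeLeft (SpanTimes.{u}.map (SimplexCategory.δ 2).op K')).left :=
      inferInstanceAs (IsIso (Arrow.leftFunc.map _))
    rw [← hK1']
    -- The left leg of F' is known to be invertible on domains only, so K' is first pushed forward
    -- along the domain functor.
    exact isIso_edgeLeft_comp
      (K := (Span.map (Arrow.leftFunc : Arrow FintypeCat.{u} ⥤ FintypeCat.{u})).app _ K') h0 h2

end SpanQuasi

theorem mainTheorem7 (F : SpanQuasi.SpanTimes.{u} _⦋1⦌) :
    SSetSlice.IsCartesian SpanQuasi.proj.{u} F ↔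
      IsPullback (SpanQuasi.edgeRight F).left (SpanQuasi.edgeApex F).hom
          (SpanQuasi.edgeTarget F).hom (SpanQuasi.edgeRight F).right ∧
        IsIso (SpanQuasi.edgeLeft F).left :=
  ⟨SpanQuasi.isPullback_and_isIso_of_isCartesian, fun h =>
    SpanQuasi.isCartesian_of_rightSquare F ((SpanQuasi.rightSquare_iff F).2 h.1)
      ((SpanQuasi.leftLegIso_iff F).2 h.2)⟩
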